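/- **Definitions.** Let $d\ge 0$. A *convex quadrilateral* $ABCD$ in $\mathbb{R}^d$ is planar and strictly convex: no three vertices are collinear, and the diagonals $AC$, $BD$ meet at a point $Q$ interior to both. The *opposite ratio* of $ABCD$ with respect to the side $AB$ is $\mathrm{Area}(AQB)/\mathrm{Area}(CQD)$. Two convex quadrilaterals $ABCD$ and $ABC'D'$ with a common side $AB$ are *affine symmetric with respect to $AB$* if some affine map fixes the points of $AB$ and takes $C$ to $C'$ and $D$ to $D'$. A $2\times 2$ *net* is a collection of nine points $P_{ij}\in\mathbb{R}^d$, $0\le i,j\le 2$ (not necessarily distinct), such that $P_{ij},P_{i+1,j},P_{i+1,j+1},P_{i,j+1}$ are consecutive vertices of a convex quadrilateral, called a *face*, for all $i,j\in\{0,1\}$. The sides of the faces are called *edges*. Faces and edges are labeled by the indices of their vertices, and a common edge of two faces is one with the same labels in both; thus the common edges are $P_{10}P_{11}$, $P_{11}P_{12}$, $P_{01}P_{11}$, $P_{11}P_{21}$. Two nets are *parallel* if the edges with the same indices are parallel, and *congruent* if an isometry of $\mathbb{R}^d$ takes each point of the first net to the point of the second net with the same indices. A net $P$ is *deformable* if there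 is a continuous family $P(t)$, $t\in[0,1]$, of pairwise non-congruent, mutually parallel nets with the same areas of corresponding faces, such that $P=P(t_0)$ for some $t_0\in[0,1]$. **Theorem 2.1.** A $2\times 2$ net in $\mathbb{R}^d$ is deformable if and only if at least one of the following conditions holds: (i) the four faces split into two pairs, each consisting of two faces with a common edge that are affine symmetric with respect to that edge; (ii) each pair of faces with a common edge has equal opposite ratios with respect to that edge. -/

import Mathlib

open scoped EuclideanGeometry

/-- Area of the triangle `ABC` in `ℝ^d`: half the product of two sides and the sine of the
angle between them. -/
noncomputable def triangleArea {d : ℕ} (A B C : EuclideanSpace ℝ (Fin d)) : ℝ :=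
  1 / 2 * dist A B * dist A C * Real.sin (∠ B A C)

/-- `A, B, C, D` are consecutive vertices of a (planar, nondegenerate, strictly) convex
quadrilateral in `ℝ^d`: the diagonals `AC` and `BD` cross at a point interior to both, and
they do not lie on one line. -/
def IsConvexQuad {d : ℕ} (A B C D : EuclideanSpace ℝ (Fin d)) : Prop :=
  ¬ Collinear ℝ {A, B, C} ∧ ∃ Q, Sbtw ℝ A Q C ∧ Sbtw ℝ B Q D

/-- Area of the convex quadrilateral `ABCD`, cut by the diagonal `AC` into two triangles. -/
noncomputable def quadArea {d : ℕ} (A B C D : EuclideanSpace ℝ (Fin d)) : ℝ :=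
  triangleArea A B C + triangleArea A C D

/-- The common point of the diagonals `AC` and `BD`
(it exists and is unique when `ABCD` is a convex quadrilateral). -/
noncomputable def diagonalPoint {d : ℕ} (A B C D : EuclideanSpace ℝ (Fin d)) :
    EuclideanSpace ℝ (Fin d) :=
  Classical.epsilon fun Q => Q ∈ segment ℝ A C ∧ Q ∈ segment ℝ B D

/-- The opposite ratio of the quadrilateral `ABCD` with respect to the side `AB`:
`Area(AQB) / Area(CQD)`, where `Q` is the common point of the diagonals. -/
noncomputable def oppositeRatio {d : ℕ} (A B C D : EuclideanSpace ℝ (Fin d)) : ℝ :=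
  triangleArea A (diagonalPoint A B C D) B / triangleArea C (diagonalPoint A B C D) D

/-- The quadrilaterals `ABCD` and `ABC'D'` are affine symmetric with respect to their common
side `AB`: an affine map takes the first to the second and fixes the points of `AB`
(an affine map fixing `A` and `B` fixes all points of the line `AB`). -/
def AffineSymmetric {d : ℕ} (A B C D C' D' : EuclideanSpace ℝ (Fin d)) : Prop :=
  ∃ φ : EuclideanSpace ℝ (Fin d) →ᵃ[ℝ] EuclideanSpace ℝ (Fin d),
    φ A = A ∧ φ B = B ∧ φ C = C' ∧ φ D = D'

/-- An `m × n` net: the points `P i j`, `0 ≤ i ≤ m`, `0 ≤ j ≤ n`, such that all the quadruples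
`P i j, P (i+1) j, P (i+1) (j+1), P i (j+1)` are consecutive vertices of convex quadrilaterals.
The points need not be distinct. -/
def IsNet {d m n : ℕ} (P : Fin (m + 1) → Fin (n + 1) → EuclideanSpace ℝ (Fin d)) : Prop :=
  ∀ (i : Fin m) (j : Fin n),
    IsConvexQuad (P i.castSucc j.castSucc) (P i.succ j.castSucc)
      (P i.succ j.succ) (P i.castSucc j.succ)

/-- Area of the face of a net with lowest-index vertex `P i j`. -/
noncomputable def faceArea {d m n : ℕ}
    (P : Fin (m + 1) → Fin (n + 1) → EuclideanSpace ℝ (Fin d)) (i : Fin m) (j : Fin n) : ℝ :=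
  quadArea (P i.castSucc j.castSucc) (P i.succ j.castSucc)
    (P i.succ j.succ) (P i.castSucc j.succ)

/-- Two nets are parallel (Combescure transformations of each other):
corresponding edges are parallel. -/
def ParallelNets {d m n : ℕ}
    (P P' : Fin (m + 1) → Fin (n + 1) → EuclideanSpace ℝ (Fin d)) : Prop :=
  (∀ (i : Fin m) (j : Fin (n + 1)),
    (affineSpan ℝ {P i.castSucc j, P i.succ j}).Parallel
      (affineSpan ℝ {P' i.castSucc j, P' i.succ j})) ∧
  (∀ (i : Fin (m + 1)) (j : Fin n),
    (affineSpan ℝ {P i j.castSucc, P i j.succ}).Parallel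
      (affineSpan ℝ {P' i j.castSucc, P' i j.succ}))

/-- Two nets are congruent: an isometry of `ℝ^d` takes each point of the first net to the point
of the second net with the same indices. -/
def CongruentNets {d m n : ℕ}
    (P P' : Fin (m + 1) → Fin (n + 1) → EuclideanSpace ℝ (Fin d)) : Prop :=
  ∃ g : EuclideanSpace ℝ (Fin d) ≃ᵢ EuclideanSpace ℝ (Fin d), ∀ i j, g (P i j) = P' i j

/-- `P` is deformable: it is a member of a continuous family, parametrized by `[0, 1]`,
of pairwise non-congruent parallel nets with the same areas of corresponding faces. -/
def Deformable {d m n : ℕ}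
    (P : Fin (m + 1) → Fin (n + 1) → EuclideanSpace ℝ (Fin d)) : Prop :=
  ∃ F : unitInterval → Fin (m + 1) → Fin (n + 1) → EuclideanSpace ℝ (Fin d),
    Continuous F ∧
    (∃ t₀, F t₀ = P) ∧
    (∀ t, IsNet (F t)) ∧
    (∀ s t, ParallelNets (F s) (F t)) ∧
    (∀ s t i j, faceArea (F s) i j = faceArea (F t) i j) ∧
    (∀ s t, s ≠ t → ¬ CongruentNets (F s) (F t))

/-- The two faces of a `2 × 2` net having the edge `P 1 0, P 1 1`, respectively `P 1 1, P 1 2`,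
in common are affine symmetric with respect to it; or the same for the common edges
`P 0 1, P 1 1` and `P 1 1, P 2 1`. These are the two ways to split the four faces into two
pairs of faces with a common edge. -/
def SplitsIntoAffineSymmetricPairs {d : ℕ}
    (P : Fin 3 → Fin 3 → EuclideanSpace ℝ (Fin d)) : Prop :=
  (AffineSymmetric (P 1 0) (P 1 1) (P 0 1) (P 0 0) (P 2 1) (P 2 0) ∧
    AffineSymmetric (P 1 1) (P 1 2) (P 0 2) (P 0 1) (P 2 2) (P 2 1)) ∨
  (AffineSymmetric (P 0 1) (P 1 1) (P 1 0) (P 0 0) (P 1 2) (P 0 2) ∧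
    AffineSymmetric (P 1 1) (P 2 1) (P 2 0) (P 1 0) (P 2 2) (P 1 2))

/-- Each pair of faces of a `2 × 2` net with a common edge has equal opposite ratios with
respect to that edge. The common edges are `P 1 0, P 1 1`; `P 1 1, P 1 2`; `P 0 1, P 1 1`;
`P 1 1, P 2 1`. -/
def EqualOppositeRatios {d : ℕ}
    (P : Fin 3 → Fin 3 → EuclideanSpace ℝ (Fin d)) : Prop :=
  oppositeRatio (P 1 0) (P 1 1) (P 0 1) (P 0 0) =
    oppositeRatio (P 1 0) (P 1 1) (P 2 1) (P 2 0) ∧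
  oppositeRatio (P 1 1) (P 1 2) (P 0 2) (P 0 1) =
    oppositeRatio (P 1 1) (P 1 2) (P 2 2) (P 2 1) ∧
  oppositeRatio (P 0 1) (P 1 1) (P 1 0) (P 0 0) =
    oppositeRatio (P 0 1) (P 1 1) (P 1 2) (P 0 2) ∧
  oppositeRatio (P 1 1) (P 2 1) (P 2 0) (P 1 0) =
    oppositeRatio (P 1 1) (P 2 1) (P 2 2) (P 1 2)

/-! Only the four edges at the central point matter. In a parallel net they are multiplied by
factors `x 0, …, x 3`; the directions of the other edges then fix each corner, so the factors
determine the net up to translation. Encode the face between the central edges `i` and `i + 1` by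
the inverse square roots `p i`, `q (i + 1)` of its opposite ratios with respect to these edges.
Preservation of its area becomes the quadratic equation `AreaRel`, and a deformation is a curve of
positive solutions of four such equations arranged in a cycle. Condition (ii) reads `p = q`, while
(i) says that two pairs of adjacent faces impose the same relation.

Sufficiency: in case (i) one factor is taken as the parameter and opposite factors are kept equal;
in case (ii) the factors are `cosh t ± p i * sinh t` with alternating signs.

Necessity is algebraic. A deformation gives infinitely many solutions, and their germs along a
nonprincipal ultrafilter form one solution transcendental over `ℝ`. One relation is a hyperbola,
parametrized rationally by a transcendental `z = c + s`. The neighbouring factors are then obtained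
by adjoining square roots of explicit elements of `ℝ(z)`. If opposite factors are proportional,
comparing coefficients gives (i). Otherwise the cycle can close only if the square root from one
side lies in the extension generated by the other. Then a quartic, or a product of two, is a square
in `ℝ[X]` (`ScalingCycle.params_cases`), which leaves `p = q` and a few degenerate patterns with
parameters equal to `1`; these are excluded by extreme coefficients (`ScalingCycle.eq_of_one_eq`,
`ScalingCycle.not_alternating`). -/

/-! ### The area relation as a hyperbola -/

/-- The relation between the scaling factors `x`, `y` of two adjacent sides of a face which says
that the area of the face is unchanged. The face is encoded by the parameters `p`, `q`, which are
the inverse square roots of its opposite ratios with respect to the two sides. -/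
def AreaRel {K : Type*} [Field K] (p q x y : K) : Prop :=
  (q * x + p * y) ^ 2 - (x - y) ^ 2 = (p + q) ^ 2

/-- The scaling factor of the coordinate of the far vertex of a face along the side
scaled by `x`, up to a constant. -/
def farCoord {K : Type*} [Field K] (p q x y : K) : K :=
  ((p * q + 1) * x + (p ^ 2 - 1) * y) / (p + q)

namespace AreaRel

variable {K : Type*} [Field K] {p q x y : K}

theorem symm (h : AreaRel p q x y) : AreaRel q p y x := by
  unfold AreaRel at *; linear_combination h

/-- Up to the factor `2 * (p + q)`, `farCoord p q x y` is the derivative of the area relation with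
respect to `y`, so its square is the normalized discriminant in `y` and does not involve `q`. -/
theorem farCoord_sq (h : AreaRel p q x y) (h0 : p + q ≠ 0) :
    farCoord p q x y ^ 2 = x ^ 2 - 1 + p ^ 2 := by
  unfold AreaRel at h; unfold farCoord
  field_simp
  linear_combination (p ^ 2 - 1) * h

/-- The linear substitution `c = (q x + p y) / (p + q)`, `s = (x - y) / (p + q)` turns the relation
into the unit hyperbola. -/
theorem exists_param (h : AreaRel p q x y) (h0 : p + q ≠ 0) :
    ∃ c s, c ^ 2 - s ^ 2 = 1 ∧ x = c + p * s ∧ y = c - q * s ∧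
      farCoord p q x y = p * c + s ∧ farCoord q p y x = q * c - s := by
  have h0' : q + p ≠ 0 := by rwa [add_comm]
  refine ⟨(q * x + p * y) / (p + q), (x - y) / (p + q), ?_, ?_, ?_, ?_, ?_⟩
  · unfold AreaRel at h
    field_simp
    linear_combination h
  · field_simp; ring
  · field_simp; ring
  · unfold farCoord; field_simp; ring
  · unfold farCoord; field_simp; ring

theorem of_param {c s : K} (h : c ^ 2 - s ^ 2 = 1) : AreaRel p q (c + p * s) (c - q * s) := by
  unfold AreaRel; linear_combination (p + q) ^ 2 * h

end AreaRel

/-- The linear system for `(c, s)` has determinant `p ^ 2 - 1`. When it vanishes the system gives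
only one of `c + s`, `c - s`, and the hyperbola supplies the other as its inverse. -/
theorem param_unique {K : Type*} [Field K] [CharZero K] {p c s c' s' : K}
    (h : c ^ 2 - s ^ 2 = 1) (h' : c' ^ 2 - s' ^ 2 = 1)
    (h1 : c + p * s = c' + p * s') (h2 : p * c + s = p * c' + s') : c = c' ∧ s = s' := by
  have e1 : (p ^ 2 - 1) * (c - c') = 0 := by linear_combination p * h2 - h1
  have e2 : (p ^ 2 - 1) * (s - s') = 0 := by linear_combination p * h1 - h2
  by_cases hp : p ^ 2 - 1 = 0
  · have : (p - 1) * (p + 1) = 0 := by linear_combination hp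
    rcases mul_eq_zero.1 this with hp | hp
    · obtain rfl : p = 1 := by linear_combination hp
      have hz : c + s ≠ 0 := by
        rintro h0
        have : (1 : K) = 0 := by linear_combination (c - s) * h0 - h
        exact one_ne_zero this
      have : c - s = c' - s' := by
        apply mul_left_cancel₀ hz
        linear_combination h - h' - (c' - s') * h1
      constructor
      · linear_combination (this + h1) / 2
      · linear_combination (h1 - this) / 2
    · obtain rfl : p = -1 := by linear_combination hp
      have hz : c - s ≠ 0 := by
        rintro h0
        have : (1 : K) = 0 := by linear_combination (c + s) * h0 - h
        exact one_ne_zero this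
      have : c + s = c' + s' := by
        apply mul_left_cancel₀ hz
        linear_combination h - h' - (c' + s') * h1
      constructor
      · linear_combination (this + h1) / 2
      · linear_combination (this - h1) / 2
  · refine ⟨sub_eq_zero.1 ((mul_eq_zero.1 e1).resolve_left hp),
      sub_eq_zero.1 ((mul_eq_zero.1 e2).resolve_left hp)⟩

/-! ### Identities and squares over a transcendental parameter -/

section Transcendental

open Polynomial

variable {L : Type*} [Field L] [Algebra ℝ L]

local notation "ι" => algebraMap ℝ L

theorem eval_eq_zero_of_transcendental {z : L} (hz : Transcendental ℝ z) {f : ℝ[X]}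
    (h : aeval z f = 0) (r : ℝ) : f.eval r = 0 := by
  rw [transcendental_iff.1 hz f h, eval_zero]

/-- With `z = c + s` one has `c - s = z⁻¹`, so `4 * z ^ 2` times the form is a polynomial in `z`,
which must vanish identically. -/
theorem quadForm_eq_zero {c s : L} (hcs : c ^ 2 - s ^ 2 = 1) (hz : Transcendental ℝ (c + s))
    {A B C : ℝ} (h : ι A * c ^ 2 + ι B * (c * s) + ι C * s ^ 2 = 0) : A = 0 ∧ B = 0 ∧ C = 0 := by
  have key : aeval (c + s) (Polynomial.C A * (X ^ 2 + 1) ^ 2 + Polynomial.C B * (X ^ 4 - 1) +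
      Polynomial.C C * (X ^ 2 - 1) ^ 2 : ℝ[X]) = 0 := by
    simp only [map_add, map_mul, map_pow, aeval_X, aeval_C, map_one, map_sub]
    have e1 : (c + s) ^ 2 + 1 = 2 * (c + s) * c := by linear_combination -hcs
    have e2 : (c + s) ^ 2 - 1 = 2 * (c + s) * s := by linear_combination hcs
    have e3 : (c + s) ^ 4 - 1 = (2 * (c + s) * c) * (2 * (c + s) * s) := by
      rw [← e1, ← e2]; ring
    rw [e1, e2, e3]
    linear_combination 4 * (c + s) ^ 2 * h
  have h0 := eval_eq_zero_of_transcendental hz key 0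
  have h1 := eval_eq_zero_of_transcendental hz key 1
  have h2 := eval_eq_zero_of_transcendental hz key 2
  simp at h0 h1 h2
  subst h1
  refine ⟨rfl, ?_, ?_⟩ <;> linarith

/-- A second area relation holding along the whole hyperbola of the first must be the same conic,
with `x` rescaled by `κ`. This recovers its parameters. -/
theorem face_params_eq {c s x y : L} {p q p' q' κ : ℝ} (hcs : c ^ 2 - s ^ 2 = 1)
    (hz : Transcendental ℝ (c + s)) (hx : x = c + ι p * s) (hy : y = c - ι q * s)
    (hq : 0 < q) (hp' : 0 < p') (hq' : 0 < q')
    (h : AreaRel (ι p') (ι q') (ι κ * x) y) :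
    q' = q ∧ (p' + q') ^ 2 = κ ^ 2 * (p + q) ^ 2 := by
  have key : ι ((q' * κ + p') ^ 2 - (κ - 1) ^ 2 - (p' + q') ^ 2) * c ^ 2 +
      ι (2 * ((q' * κ + p') * (q' * κ * p - p' * q) - (κ - 1) * (κ * p + q))) * (c * s) +
      ι ((q' * κ * p - p' * q) ^ 2 - (κ * p + q) ^ 2 + (p' + q') ^ 2) * s ^ 2 = 0 := by
    unfold AreaRel at h
    subst hx hy
    simp only [map_add, map_mul, map_pow, map_one, map_sub, map_ofNat]
    linear_combination h - (ι p' + ι q') ^ 2 * hcs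
  obtain ⟨hA, hB, hC⟩ := quadForm_eq_zero hcs hz key
  have hK : 0 < (p' + q') ^ 2 := by positivity
  have e1 : (p' + q') ^ 2 = κ ^ 2 * (p + q) ^ 2 := by
    apply mul_left_cancel₀ hK.ne'
    set B' := (q' * κ + p') * (q' * κ * p - p' * q) - (κ - 1) * (κ * p + q) with hB'
    have hB0 : B' = 0 := by linarith
    -- Discriminants of the two proportional quadratic forms are compared.
    have : B' ^ 2 - ((q' * κ + p') ^ 2 - (κ - 1) ^ 2) *
        ((q' * κ * p - p' * q) ^ 2 - (κ * p + q) ^ 2) = κ ^ 2 * (p' + q') ^ 2 * (p + q) ^ 2 := by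
      rw [hB']; ring
    rw [hB0] at this
    have hA' : (q' * κ + p') ^ 2 - (κ - 1) ^ 2 = (p' + q') ^ 2 := by linarith
    have hC' : (q' * κ * p - p' * q) ^ 2 - (κ * p + q) ^ 2 = - (p' + q') ^ 2 := by linarith
    rw [hA', hC'] at this
    linarith
  refine ⟨?_, e1⟩
  -- The form is evaluated at `(c, s) = (q, 1)`, where `y = c - q * s` vanishes.
  have : (p' + q') ^ 2 * (q' ^ 2 - q ^ 2) = 0 := by
    linear_combination q ^ 2 * hA + q * hB + hC + (q' ^ 2 - 1) * e1
  have : q' ^ 2 = q ^ 2 := by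
    have := (mul_eq_zero.1 this).resolve_left hK.ne'
    linarith
  exact (sq_eq_sq₀ hq'.le hq.le).1 this

/-- Since `ℝ[X]` is integrally closed, a polynomial that is a square in `ℝ(z) ≅ ℝ(X)` is already the
square of a polynomial. -/
theorem isSquare_of_aeval_eq_sq {z : L} (hz : Transcendental ℝ z) {f : ℝ[X]} {w : L}
    (hw : w ∈ IntermediateField.adjoin ℝ {z}) (h : aeval z f = w ^ 2) : IsSquare f := by
  obtain ⟨a, b, rfl⟩ := (IntermediateField.mem_adjoin_simple_iff ℝ w).1 hw
  by_cases hb : b = 0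
  · subst hb
    have : f = 0 := transcendental_iff.1 hz f (by simpa using h)
    exact this ▸ IsSquare.zero
  have hb' : aeval z b ≠ 0 := fun h0 => hb (transcendental_iff.1 hz b h0)
  have e : f * b ^ 2 = a ^ 2 := by
    rw [← sub_eq_zero]
    apply transcendental_iff.1 hz
    simp only [map_sub, map_mul, map_pow, h, div_pow]
    rw [div_mul_cancel₀ _ (pow_ne_zero 2 hb'), sub_self]
  have hdvd : b ^ 2 ∣ a ^ 2 := ⟨f, by rw [← e]; ring⟩
  obtain ⟨g, rfl⟩ := (IsIntegrallyClosed.pow_dvd_pow_iff two_ne_zero).1 hdvd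
  refine ⟨g, mul_left_cancel₀ (pow_ne_zero 2 hb) ?_⟩
  linear_combination e

end Transcendental

/-! ### Biquadratic polynomials and quadratic extensions -/

section Transcendental
open Polynomial

/-- The quartic `X ^ 2 * ((a * X + b / X) ^ 2 - m)`. -/
noncomputable def laurentQuartic (a b m : ℝ) : ℝ[X] := (C a * X ^ 2 + C b) ^ 2 - C m * X ^ 2

theorem eval_laurentQuartic (a b m r : ℝ) :
    (laurentQuartic a b m).eval r = (a * r ^ 2 + b) ^ 2 - m * r ^ 2 := by
  simp [laurentQuartic]

theorem laurentQuartic_eq (a b m : ℝ) : laurentQuartic a b m =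
    C (a ^ 2) * X ^ 4 + C (2 * a * b - m) * X ^ 2 + C (b ^ 2) := by
  simp only [laurentQuartic, map_sub, map_mul, map_pow, map_ofNat]
  ring

theorem natDegree_laurentQuartic {a : ℝ} (ha : a ≠ 0) (b m : ℝ) :
    (laurentQuartic a b m).natDegree = 4 := by
  rw [laurentQuartic_eq]
  compute_degree!

theorem natDegree_laurentQuartic_le (a b m : ℝ) :
    (laurentQuartic a b m).natDegree ≤ 4 := by
  rw [laurentQuartic_eq]
  compute_degree!

/-- A square root has degree two and no linear term, since the quartic is even with nonzero leading
coefficient. It is `±(a * X ^ 2 ± b)`, and the two relative signs give the two values of `m`. -/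
theorem eq_zero_or_of_isSquare_laurentQuartic {a b m : ℝ} (ha : a ≠ 0)
    (h : IsSquare (laurentQuartic a b m)) : m = 0 ∨ m = 4 * a * b := by
  obtain ⟨W, hW⟩ := h
  have hdeg : W.natDegree = 2 := by
    have := natDegree_laurentQuartic ha b m
    rw [hW, ← sq, natDegree_pow] at this
    lia
  have hW2 := eq_quadratic_of_degree_le_two (p := W)
    (natDegree_le_iff_degree_le.1 hdeg.le)
  set u := W.coeff 2
  set v := W.coeff 1
  set w := W.coeff 0
  have ev : ∀ r : ℝ, (a * r ^ 2 + b) ^ 2 - m * r ^ 2 = (u * r ^ 2 + v * r + w) ^ 2 := by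
    intro r
    rw [← eval_laurentQuartic, hW, hW2]
    simp [sq]
  have h0 := ev 0
  have h1 := ev 1
  have h1' := ev (-1)
  have h2 := ev 2
  have h2' := ev (-2)
  have e4 : u ^ 2 = a ^ 2 := by linarith
  have e3 : u * v = 0 := by linarith
  have e2 : v ^ 2 + 2 * (u * w) = 2 * a * b - m := by linarith
  have e0 : w ^ 2 = b ^ 2 := by linarith
  have hu : u ≠ 0 := fun h0 => ha (by rw [h0] at e4; simpa using e4.symm)
  have hv : v = 0 := (mul_eq_zero.1 e3).resolve_left hu
  have : (u * w) ^ 2 = (a * b) ^ 2 := by rw [mul_pow, mul_pow, e4, e0]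
  rcases sq_eq_sq_iff_eq_or_eq_neg.1 this with h | h
  · left; rw [hv, h] at e2; linarith
  · right; rw [hv, h] at e2; linarith

theorem squarefree_laurentQuartic {a b m : ℝ} (hb : b ≠ 0) (hm : m ≠ 0)
    (hm' : m ≠ 4 * a * b) : Squarefree (laurentQuartic a b m) := by
  apply Polynomial.Separable.squarefree
  -- `D` is the discriminant of the quartic as a quadratic in `X ^ 2`; `b ≠ 0` keeps `0` from being
  -- a root. Bézout coefficients are given explicitly below.
  set D := m * (m - 4 * a * b) with hD
  have hD0 : 2 * D * b ^ 2 ≠ 0 := by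
    have : m - 4 * a * b ≠ 0 := sub_ne_zero.2 hm'
    positivity
  have hder : derivative (laurentQuartic a b m) =
      2 * X * (2 * C (a ^ 2) * X ^ 2 + C (2 * a * b - m)) := by
    rw [laurentQuartic_eq]
    simp only [derivative_add, derivative_mul, derivative_C, derivative_X_pow]
    simp only [map_sub, map_mul, map_pow, map_ofNat, Nat.cast_ofNat]
    ring
  have hinv : C (2 * D * b ^ 2)⁻¹ * C (2 * D * b ^ 2) = 1 := by
    rw [← C_mul, inv_mul_cancel₀ hD0, C_1]
  refine ⟨C (2 * D * b ^ 2)⁻¹ * (2 * C D + 8 * C (a ^ 2) * X ^ 2 *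
      (C (a ^ 2) * X ^ 2 + C (2 * a * b - m))),
    C (2 * D * b ^ 2)⁻¹ * (-(C (a ^ 2) * X ^ 2 + C (2 * a * b - m)) * X *
      (2 * C (a ^ 2) * X ^ 2 + C (2 * a * b - m))), ?_⟩
  rw [hder, ← hinv, laurentQuartic_eq, hD]
  simp only [map_sub, map_mul, map_pow, map_ofNat]
  ring

theorem dvd_of_squarefree_of_isSquare_mul {f g : ℝ[X]} (hf : Squarefree f)
    (h : IsSquare (f * g)) : f ∣ g := by
  obtain ⟨W, hW⟩ := h
  have h1 : f ∣ W := by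
    rw [← hf.dvd_pow_iff_dvd two_ne_zero, sq, ← hW]
    exact dvd_mul_right f g
  obtain ⟨V, rfl⟩ := h1
  refine ⟨V * V, mul_left_cancel₀ hf.ne_zero ?_⟩
  rw [hW]; ring

/-- By degrees the quotient is a constant, so the leading and constant coefficients of the two
quartics are proportional. -/
theorem laurentQuartic_dvd {a b m a' b' m' : ℝ} (ha : a ≠ 0)
    (h : laurentQuartic a b m ∣ laurentQuartic a' b' m') :
    a' ^ 2 * b ^ 2 = a ^ 2 * b' ^ 2 := by
  obtain ⟨g, hg⟩ := h
  by_cases h0 : g = 0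
  · have ev : ∀ r : ℝ, (a' * r ^ 2 + b') ^ 2 - m' * r ^ 2 = 0 := by
      intro r
      rw [← eval_laurentQuartic, hg, h0]; simp
    have e0 := ev 0
    have e1 := ev 1
    have e2 := ev 2
    have hb0 : b' = 0 := by
      have : b' ^ 2 = 0 := by linarith
      simpa using this
    subst hb0
    have : a' ^ 2 = 0 := by linarith
    rw [this]; ring
  have hf : laurentQuartic a b m ≠ 0 := fun h => by
    have := natDegree_laurentQuartic ha b m
    rw [h] at this; simp at this
  have hdeg : g.natDegree = 0 := by
    have h1 := natDegree_laurentQuartic_le a' b' m'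
    rw [hg, natDegree_mul hf h0, natDegree_laurentQuartic ha] at h1
    lia
  rw [eq_C_of_natDegree_eq_zero hdeg] at hg
  set k := g.coeff 0
  have ev : ∀ r : ℝ, (a' * r ^ 2 + b') ^ 2 - m' * r ^ 2 =
      ((a * r ^ 2 + b) ^ 2 - m * r ^ 2) * k := by
    intro r
    rw [← eval_laurentQuartic, hg, eval_mul, eval_laurentQuartic, eval_C]
  have e0 := ev 0
  have e1 := ev 1
  have e2 := ev 2
  have h4 : a' ^ 2 = a ^ 2 * k := by linarith
  have h0 : b' ^ 2 = b ^ 2 * k := by linarith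
  rw [h4, h0]; ring

/-- The field `K(B)` for `B` quadratic over the intermediate field `K`. -/
def quadExt {F L : Type*} [Field F] [Field L] [Algebra F L] (K : IntermediateField F L) (B : L)
    (hB : B ^ 2 ∈ K) (hB' : B ∉ K) : IntermediateField F L where
  carrier := {w | ∃ u ∈ K, ∃ v ∈ K, w = u + v * B}
  add_mem' := by
    rintro _ _ ⟨u, hu, v, hv, rfl⟩ ⟨u', hu', v', hv', rfl⟩
    exact ⟨u + u', add_mem hu hu', v + v', add_mem hv hv', by ring⟩
  mul_mem' := by
    rintro _ _ ⟨u, hu, v, hv, rfl⟩ ⟨u', hu', v', hv', rfl⟩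
    exact ⟨u * u' + v * v' * B ^ 2, add_mem (mul_mem hu hu') (mul_mem (mul_mem hv hv') hB),
      u * v' + v * u', add_mem (mul_mem hu hv') (mul_mem hv hu'), by ring⟩
  algebraMap_mem' r := ⟨algebraMap F L r, K.algebraMap_mem r, 0, K.zero_mem, by ring⟩
  inv_mem' := by
    rintro _ ⟨u, hu, v, hv, rfl⟩
    have hmem : u ^ 2 - v ^ 2 * B ^ 2 ∈ K := sub_mem (pow_mem hu 2) (mul_mem (pow_mem hv 2) hB)
    by_cases h : u + v * B = 0
    · exact ⟨0, K.zero_mem, 0, K.zero_mem, by rw [h]; simp⟩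
    have h' : u - v * B ≠ 0 := by
      intro h'
      by_cases hv0 : v = 0
      · subst hv0
        apply h; linear_combination h'
      · apply hB'
        have : B = u / v := by
          rw [eq_div_iff hv0]; linear_combination -h'
        rw [this]
        exact div_mem hu hv
    have hn : u ^ 2 - v ^ 2 * B ^ 2 ≠ 0 := by
      rw [show u ^ 2 - v ^ 2 * B ^ 2 = (u + v * B) * (u - v * B) by ring]
      exact mul_ne_zero h h'
    refine ⟨u / (u ^ 2 - v ^ 2 * B ^ 2), div_mem hu hmem, -v / (u ^ 2 - v ^ 2 * B ^ 2),
      div_mem (neg_mem hv) hmem, ?_⟩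
    rw [inv_eq_iff_eq_inv]
    refine eq_inv_of_mul_eq_one_left ?_
    field_simp
    ring

/-- Kummer theory in degree two: write `w = u + v * B` over `K`. As `w ^ 2` lies in `K` and `B` does
not, the cross term `2 * u * v` vanishes. -/
theorem exists_sq_of_sq_mem {F L : Type*} [Field F] [Field L] [Algebra F L] [CharZero L]
    {K : IntermediateField F L} {B w : L} (hB : B ^ 2 ∈ K) (hw2 : w ^ 2 ∈ K)
    (hw : ∀ M : IntermediateField F L, K ≤ M → B ∈ M → w ∈ M) :
    w ∈ K ∨ B ∉ K ∧ w * B ∈ K := by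
  by_cases hBK : B ∈ K
  · exact Or.inl (hw K le_rfl hBK)
  obtain ⟨u, hu, v, hv, h⟩ := hw (quadExt K B hB hBK)
    (fun u hu => ⟨u, hu, 0, K.zero_mem, by ring⟩) ⟨0, K.zero_mem, 1, K.one_mem, by ring⟩
  have h2 : (2 * u * v) * B ∈ K := by
    have : (2 * u * v) * B = w ^ 2 - u ^ 2 - v ^ 2 * B ^ 2 := by rw [h]; ring
    rw [this]
    exact sub_mem (sub_mem hw2 (pow_mem hu 2)) (mul_mem (pow_mem hv 2) hB)
  have h2mem : (2 : L) ∈ K := by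
    rw [← one_add_one_eq_two]; exact add_mem K.one_mem K.one_mem
  by_cases huv : 2 * u * v = 0
  · have : u = 0 ∨ v = 0 := by simpa using huv
    rcases this with rfl | rfl
    · right
      refine ⟨hBK, ?_⟩
      have : w * B = v * B ^ 2 := by rw [h]; ring
      rw [this]; exact mul_mem hv hB
    · left
      rw [h]; simpa using hu
  · exfalso
    apply hBK
    have : B = (2 * u * v * B) / (2 * u * v) := (mul_div_cancel_left₀ _ huv).symm
    rw [this]
    exact div_mem h2 (mul_mem (mul_mem h2mem hu) hv)

end Transcendental

/-! ### Cyclic systems of area relations -/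

section ScalingCycle
open Polynomial

variable {L : Type*} [Field L] [Algebra ℝ L]

local notation "ι" => algebraMap ℝ L

theorem algebraMap_add_ne_zero {p q : ℝ} (hp : 0 < p) (hq : 0 < q) : ι p + ι q ≠ 0 := by
  rw [← map_add, _root_.map_ne_zero]; positivity

theorem transcendental_param {c s : L} {p : ℝ} (hcs : c ^ 2 - s ^ 2 = 1)
    (h : Transcendental ℝ (c + ι p * s)) : Transcendental ℝ (c + s) := by
  have : CharZero L := charZero_of_injective_algebraMap (algebraMap ℝ L).injective
  intro hz
  apply h
  have hinv : (c + s)⁻¹ = c - s := by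
    apply inv_eq_of_mul_eq_one_right
    linear_combination hcs
  have e : c + ι p * s = ι ((1 + p) / 2) * (c + s) + ι ((1 - p) / 2) * (c + s)⁻¹ := by
    rw [hinv]
    simp only [map_div₀, map_add, map_sub, map_one, map_ofNat]
    ring
  rw [e]
  exact ((isAlgebraic_algebraMap _).mul hz).add ((isAlgebraic_algebraMap _).mul hz.inv)

theorem mem_adjoin_param {c s : L} (hcs : c ^ 2 - s ^ 2 = 1) :
    c ∈ IntermediateField.adjoin ℝ {c + s} ∧ s ∈ IntermediateField.adjoin ℝ {c + s} := by
  have : CharZero L := charZero_of_injective_algebraMap (algebraMap ℝ L).injective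
  set K := IntermediateField.adjoin ℝ {c + s}
  have hz : c + s ∈ K := IntermediateField.mem_adjoin_simple_self ℝ _
  have hinv : (c + s)⁻¹ = c - s := by
    apply inv_eq_of_mul_eq_one_right
    linear_combination hcs
  have hz' : c - s ∈ K := hinv ▸ inv_mem hz
  have h2 : (2 : L) ∈ K := by simpa only [map_ofNat] using K.algebraMap_mem 2
  constructor
  · have : c = ((c + s) + (c - s)) / 2 := by ring
    rw [this]; exact div_mem (add_mem hz hz') h2
  · have : s = ((c + s) - (c - s)) / 2 := by ring
    rw [this]; exact div_mem (sub_mem hz hz') h2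

/-- At `p = 1` the relation has no `y ^ 2` term and determines `y` rationally. -/
theorem AreaRel.mem_of_linear {p q : ℝ} {x y : L} (h : AreaRel (ι p) (ι q) x y) (hp : p = 1)
    (hq : 0 < q) (hx0 : x ≠ 0) {M : IntermediateField ℝ L} (hx : x ∈ M) : y ∈ M := by
  have : CharZero L := charZero_of_injective_algebraMap (algebraMap ℝ L).injective
  subst hp
  have hq' : ι (q + 1) ≠ 0 := by rw [_root_.map_ne_zero]; positivity
  have e : y = (ι (1 + q) - ι (q - 1) * x ^ 2) / (ι 2 * x) := by
    rw [eq_div_iff (mul_ne_zero (by simp) hx0)]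
    apply mul_left_cancel₀ hq'
    unfold AreaRel at h
    simp only [map_add, map_sub, map_one, map_ofNat] at h ⊢
    linear_combination h
  rw [e]
  exact div_mem (sub_mem (M.algebraMap_mem _) (mul_mem (M.algebraMap_mem _) (pow_mem hx 2)))
    (mul_mem (M.algebraMap_mem _) hx)

theorem AreaRel.mem_of_farCoord_mem {p q : ℝ} {x y : L} (h : AreaRel (ι p) (ι q) x y)
    (hp : 0 < p) (hq : 0 < q) (hx0 : x ≠ 0) {M : IntermediateField ℝ L} (hx : x ∈ M)
    (hf : farCoord (ι p) (ι q) x y ∈ M) : y ∈ M := by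
  by_cases hp1 : p = 1
  · exact h.mem_of_linear hp1 hq hx0 hx
  have hp2 : ι (p ^ 2 - 1) ≠ 0 := by
    rw [_root_.map_ne_zero]
    intro h0
    have : (p - 1) * (p + 1) = 0 := by linarith
    rcases mul_eq_zero.1 this with h | h
    · exact hp1 (by linarith)
    · linarith
  have hpq := algebraMap_add_ne_zero (L := L) hp hq
  have e : y = (ι (p + q) * farCoord (ι p) (ι q) x y - ι (p * q + 1) * x) / ι (p ^ 2 - 1) := by
    rw [eq_div_iff hp2]
    unfold farCoord
    simp only [map_add, map_sub, map_one, map_mul, map_pow]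
    field_simp
    ring
  rw [e]
  exact div_mem (sub_mem (mul_mem (M.algebraMap_mem _) hf) (mul_mem (M.algebraMap_mem _) hx))
    (M.algebraMap_mem _)

theorem farCoord_mem {p q : ℝ} {x y : L} {M : IntermediateField ℝ L} (hx : x ∈ M) (hy : y ∈ M) :
    farCoord (ι p) (ι q) x y ∈ M := by
  have e : farCoord (ι p) (ι q) x y = (ι (p * q + 1) * x + ι (p ^ 2 - 1) * y) / ι (p + q) := by
    simp [farCoord]
  rw [e]
  exact div_mem (add_mem (mul_mem (M.algebraMap_mem _) hx) (mul_mem (M.algebraMap_mem _) hy))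
    (M.algebraMap_mem _)

/-- Two area relations for the same unknown `y` determine it rationally, unless the other
variables `x`, `x'` are proportional. -/
theorem AreaRel.mem_of_not_proportional {p q p' q' : ℝ} {x x' y : L}
    (h : AreaRel (ι p) (ι q) x y) (h' : AreaRel (ι p') (ι q') x' y) (hp : 0 < p) (hq : 0 < q)
    (hp' : 0 < p') (hq' : 0 < q') (hx0 : x ≠ 0) (hne : ¬ ∃ κ : ℝ, x' = ι κ * x)
    {M : IntermediateField ℝ L} (hx : x ∈ M) (hx' : x' ∈ M) : y ∈ M := by
  have : CharZero L := charZero_of_injective_algebraMap (algebraMap ℝ L).injective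
  by_cases hp1 : p = 1
  · exact h.mem_of_linear hp1 hq hx0 hx
  have hp2 : p ^ 2 - 1 ≠ 0 := by
    intro h0
    have : (p - 1) * (p + 1) = 0 := by linarith
    rcases mul_eq_zero.1 this with h | h
    · exact hp1 (by linarith)
    · linarith
  set A := (p ^ 2 - 1) * (p' * q' + 1) with hA
  set B := (p' ^ 2 - 1) * (p * q + 1) with hB
  have hA0 : A ≠ 0 := mul_ne_zero hp2 (by positivity)
  have hD : ι B * x - ι A * x' ≠ 0 := by
    intro h0
    refine hne ⟨B / A, ?_⟩
    have : ι A ≠ 0 := by rwa [_root_.map_ne_zero]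
    rw [map_div₀]
    field_simp
    linear_combination -h0
  -- Eliminating `y ^ 2` from the two quadratics leaves a linear equation for `y`, whose leading
  -- coefficient is nonzero by `hD`.
  have e : y = (ι (p' ^ 2 - 1) * (ι ((p + q) ^ 2) - ι (q ^ 2 - 1) * x ^ 2) -
      ι (p ^ 2 - 1) * (ι ((p' + q') ^ 2) - ι (q' ^ 2 - 1) * x' ^ 2)) /
      (ι 2 * (ι B * x - ι A * x')) := by
    rw [eq_div_iff (mul_ne_zero (by simp) hD), hA, hB]
    unfold AreaRel at h h'
    simp only [map_add, map_sub, map_one, map_ofNat, map_mul, map_pow]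
    linear_combination (ι p' ^ 2 - 1) * h - (ι p ^ 2 - 1) * h'
  rw [e]
  have hι := M.algebraMap_mem
  exact div_mem (sub_mem (mul_mem (hι _) (sub_mem (hι _) (mul_mem (hι _) (pow_mem hx 2))))
    (mul_mem (hι _) (sub_mem (hι _) (mul_mem (hι _) (pow_mem hx' 2)))))
    (mul_mem (hι _) (sub_mem (mul_mem (hι _) hx) (mul_mem (hι _) hx')))

/-- A solution, transcendental over `ℝ`, of the system of area relations along the four faces
of a `2 × 2` net. -/
structure ScalingCycle (p q : Fin 4 → ℝ) (x : Fin 4 → L) : Prop where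
  p_pos : ∀ i, 0 < p i
  q_pos : ∀ i, 0 < q i
  transcendental : ∀ i, Transcendental ℝ (x i)
  rel : ∀ i, AreaRel (ι (p i)) (ι (q (i + 1))) (x i) (x (i + 1))
  -- At each side both adjacent faces contribute a square root of a discriminant. For nets both are
  -- positive, so equal squares force equal roots; over a general field only this consequence of
  -- positivity is kept.
  branch : ∀ i, farCoord (ι (p (i + 1))) (ι (q (i + 2))) (x (i + 1)) (x (i + 2)) +
    farCoord (ι (q (i + 1))) (ι (p i)) (x (i + 1)) (x i) ≠ 0

namespace ScalingCycle

variable {p q : Fin 4 → ℝ} {x : Fin 4 → L}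

theorem rotate (h : ScalingCycle p q x) (k : Fin 4) :
    ScalingCycle (fun i => p (i + k)) (fun i => q (i + k)) (fun i => x (i + k)) where
  p_pos i := h.p_pos _
  q_pos i := h.q_pos _
  transcendental i := h.transcendental _
  rel i := by
    have := h.rel (i + k)
    rwa [add_right_comm] at this
  branch i := by
    have := h.branch (i + k)
    rwa [add_right_comm i k 1, add_right_comm i k 2] at this

theorem reflect (h : ScalingCycle p q x) (k : Fin 4) :
    ScalingCycle (fun i => q (k - i)) (fun i => p (k - i)) (fun i => x (k - i)) where
  p_pos i := h.q_pos _
  q_pos i := h.p_pos _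
  transcendental i := h.transcendental _
  rel i := by
    have := (h.rel (k - (i + 1))).symm
    have e : ∀ k i : Fin 4, k - (i + 1) + 1 = k - i := by decide
    rwa [e] at this
  branch i := by
    have := h.branch (k - (i + 2))
    rw [add_comm] at this
    have e : ∀ k i : Fin 4, k - (i + 2) + 1 = k - (i + 1) := by decide
    have e' : ∀ k i : Fin 4, k - (i + 2) + 2 = k - i := by decide
    rwa [e, e'] at this

theorem ne_zero (h : ScalingCycle p q x) (i : Fin 4) : x i ≠ 0 :=
  fun h0 => h.transcendental i (h0 ▸ isAlgebraic_zero)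

theorem exists_param (h : ScalingCycle p q x) : ∃ c s, c ^ 2 - s ^ 2 = 1 ∧
    Transcendental ℝ (c + s) ∧ x 0 = c + ι (p 0) * s ∧ x 1 = c - ι (q 1) * s ∧
    farCoord (ι (q 1)) (ι (p 0)) (x 1) (x 0) = ι (q 1) * c - s := by
  obtain ⟨c, s, hcs, h0, h1, -, h3⟩ := (h.rel 0).exists_param
    (algebraMap_add_ne_zero (h.p_pos 0) (h.q_pos _))
  exact ⟨c, s, hcs, transcendental_param hcs (h0 ▸ h.transcendental 0), h0, h1, h3⟩

/-- When `p 1 = q 1`, faces 0 and 1 have the same discriminant at side 1, and `branch` selects the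
same root. By `param_unique` the parameter of face 0 then serves for face 1, with `s` negated. -/
theorem param_of_eq (h : ScalingCycle p q x) (hpq : p 1 = q 1) {c s : L} (hcs : c ^ 2 - s ^ 2 = 1)
    (h1 : x 1 = c - ι (q 1) * s)
    (hf : farCoord (ι (q 1)) (ι (p 0)) (x 1) (x 0) = ι (q 1) * c - s) :
    x 2 = c + ι (q 2) * s ∧ farCoord (ι (p 1)) (ι (q 2)) (x 1) (x 2) = ι (q 1) * c - s := by
  have : CharZero L := charZero_of_injective_algebraMap (algebraMap ℝ L).injective
  have hn := algebraMap_add_ne_zero (L := L) (h.p_pos 1) (h.q_pos 2)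
  obtain ⟨c', s', hcs', h1', h2', hf', -⟩ := (h.rel 1).exists_param hn
  have e1 := (h.rel 1).farCoord_sq hn
  have e2 := (h.rel 0).symm.farCoord_sq (algebraMap_add_ne_zero (h.q_pos 1) (h.p_pos 0))
  have hb := h.branch 0
  simp only [Fin.reduceAdd, zero_add] at *
  rw [hpq] at e1
  have e : farCoord (ι (p 1)) (ι (q 2)) (x 1) (x 2) =
      farCoord (ι (q 1)) (ι (p 0)) (x 1) (x 0) := by
    rw [← sub_eq_zero]
    refine (mul_eq_zero.1 ?_).resolve_left hb
    rw [hpq]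
    linear_combination e1 - e2
  obtain ⟨rfl, hs⟩ := param_unique (p := ι (q 1)) (c := c) (s := -s) (c' := c') (s' := s')
    (by linear_combination hcs) hcs' (by rw [hpq] at h1'; linear_combination h1' - h1)
    (by rw [hpq] at hf' e; linear_combination hf' - e - hf)
  exact ⟨by rw [h2', ← hs]; ring, by rw [e, hf]⟩

end ScalingCycle
end ScalingCycle

/-! ### Classification of transcendental solutions -/

section ScalingCycle
open Polynomial

variable {L : Type*} [Field L] [Algebra ℝ L]

local notation "ι" => algebraMap ℝ L

theorem aeval_laurentQuartic_of_sq {z w X : L} {a b m : ℝ} (hz : z ≠ 0)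
    (hX : X = ι a * z + ι b * z⁻¹) (hw : w ^ 2 = X ^ 2 - ι m) :
    aeval z (laurentQuartic a b m) = (z * w) ^ 2 := by
  simp only [laurentQuartic, map_sub, map_mul, map_add, map_pow, aeval_C, aeval_X]
  rw [mul_pow, hw, hX]
  field_simp

/-- After multiplication by `y ^ 3` the identity is a polynomial one, and its constant coefficients
are compared. -/
theorem mul_sq_eq_of_laurent_identity {y x x' : L} (hy : Transcendental ℝ y)
    {a b a' b' p q : ℝ}
    (hx : x = ι a * y + ι b * y⁻¹) (hx' : x' = ι a' * y + ι b' * y⁻¹)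
    (h : x' * (ι (1 + p) - ι (p - 1) * x ^ 2) = x * (ι (1 + q) - ι (q - 1) * x' ^ 2)) :
    b' * b ^ 2 * (1 - p) = b * b' ^ 2 * (1 - q) := by
  have hy0 : y ≠ 0 := fun h0 => hy (h0 ▸ isAlgebraic_zero)
  have key : aeval y ((C a' * X ^ 2 + C b') * (C (1 + p) * X ^ 2 -
      C (p - 1) * (C a * X ^ 2 + C b) ^ 2) - (C a * X ^ 2 + C b) * (C (1 + q) * X ^ 2 -
      C (q - 1) * (C a' * X ^ 2 + C b') ^ 2) : ℝ[X]) = 0 := by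
    simp only [map_sub, map_mul, map_pow, aeval_C, aeval_X, map_add, map_one] at h ⊢
    have e : ι a * y ^ 2 + ι b = y * x := by rw [hx]; field_simp
    have e' : ι a' * y ^ 2 + ι b' = y * x' := by rw [hx']; field_simp
    rw [e, e']
    linear_combination y ^ 3 * h
  have := eval_eq_zero_of_transcendental hy key 0
  simp at this
  linarith

namespace ScalingCycle

variable {p q : Fin 4 → ℝ} {x : Fin 4 → L}

theorem laurent {c s : L} (hcs : c ^ 2 - s ^ 2 = 1) (r : ℝ) :
    c + ι r * s = ι ((1 + r) / 2) * (c + s) + ι ((1 - r) / 2) * (c + s)⁻¹ := by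
  have : CharZero L := charZero_of_injective_algebraMap (algebraMap ℝ L).injective
  have hinv : (c + s)⁻¹ = c - s := by
    apply inv_eq_of_mul_eq_one_right
    linear_combination hcs
  rw [hinv]
  simp only [map_div₀, map_add, map_sub, map_one, map_ofNat]
  ring

/-- Faces 0 and 1 relate `x 1` to proportional quantities, so `face_params_eq` identifies their
parameters and the common parametrization forces `κ = 1`. Faces 2 and 3, which meet along side 3,
are then compared in the same way. -/
theorem eq_of_proportional (h : ScalingCycle p q x) {κ : ℝ} (hκ : x 2 = ι κ * x 0) :
    q 1 = p 1 ∧ p 0 = q 2 ∧ p 2 = q 0 ∧ p 3 = q 3 := by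
  obtain ⟨c, s, hcs, hz, h0, h1, hf⟩ := h.exists_param
  have hr1 := (h.rel 1).symm
  have hr2 := h.rel 2
  have hr3 := (h.rel 3).symm
  have hn := algebraMap_add_ne_zero (L := L) (h.q_pos 0) (h.p_pos 3)
  simp only [Fin.reduceAdd] at hr1 hr2 hr3
  have e1 := (face_params_eq hcs hz h0 h1 (h.q_pos 1) (h.q_pos 2) (h.p_pos 1) (hκ ▸ hr1)).1
  obtain ⟨h2, -⟩ := h.param_of_eq e1 hcs h1 hf
  have key : ι (1 - κ) * c ^ 2 + ι (q 2 - κ * p 0) * (c * s) + ι 0 * s ^ 2 = 0 := by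
    simp only [map_sub, map_mul, map_one, map_zero]
    rw [h0, h2] at hκ
    linear_combination c * hκ
  obtain ⟨hA, hB, -⟩ := quadForm_eq_zero hcs hz key
  obtain rfl : κ = 1 := by linarith
  have e2 : p 0 = q 2 := by linarith
  obtain ⟨c', s', hcs', h0', h3', -⟩ := hr3.exists_param hn
  have hz' := transcendental_param hcs' (h0' ▸ h.transcendental 0)
  obtain ⟨e3, e4⟩ := face_params_eq hcs' hz' h0' h3' (h.p_pos 3) (h.p_pos 2) (h.q_pos 3)
    (hκ ▸ hr2)
  refine ⟨e1.symm, e2, ?_, e3.symm⟩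
  rw [one_pow, one_mul, sq_eq_sq₀ (add_pos (h.p_pos 2) (h.q_pos 3)).le
    (add_pos (h.q_pos 0) (h.p_pos 3)).le] at e4
  linarith

/-- Let `K = ℝ(z)` come from face 0. Going round one way needs the root `B` at side 1, and the other
way the root `w` at side 0. Both ways meet at `x 3`, so `w ∈ K(B)`; hence `w` or `w * B` is in `K`,
and a quartic or a product of two quartics is a square. -/
theorem params_cases (h : ScalingCycle p q x) (hne : ¬ ∃ κ : ℝ, x 2 = ι κ * x 0) :
    q 0 = 1 ∨ q 0 = p 0 ∨ p 1 ≠ q 1 ∧ p 0 = 1 ∧ q 1 = 1 := by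
  have : CharZero L := charZero_of_injective_algebraMap (algebraMap ℝ L).injective
  obtain ⟨c, s, hcs, hz, h0, h1, hf⟩ := h.exists_param
  obtain ⟨hc, hs⟩ := mem_adjoin_param hcs
  set K := IntermediateField.adjoin ℝ {c + s}
  have hι := K.algebraMap_mem
  have hx0 : x 0 ∈ K := h0 ▸ add_mem hc (mul_mem (hι _) hs)
  have hx1 : x 1 ∈ K := h1 ▸ sub_mem hc (mul_mem (hι _) hs)
  have hr1 := h.rel 1
  have hr2 := h.rel 2
  have hr3 := (h.rel 3).symm
  simp only [Fin.reduceAdd] at hr1 hr2 hr3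
  set B := farCoord (ι (p 1)) (ι (q 2)) (x 1) (x 2) with hB
  set w := farCoord (ι (q 0)) (ι (p 3)) (x 0) (x 3) with hw
  have hB2 : B ^ 2 = x 1 ^ 2 - ι (1 - p 1 ^ 2) := by
    rw [hB, hr1.farCoord_sq (algebraMap_add_ne_zero (h.p_pos 1) (h.q_pos 2))]
    simp only [map_sub, map_one, map_pow]; ring
  have hw2 : w ^ 2 = x 0 ^ 2 - ι (1 - q 0 ^ 2) := by
    rw [hw, hr3.farCoord_sq (algebraMap_add_ne_zero (h.q_pos 0) (h.p_pos 3))]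
    simp only [map_sub, map_one, map_pow]; ring
  have hz0 : c + s ≠ 0 := fun h0 => hz (h0 ▸ isAlgebraic_zero)
  have hzK : c + s ∈ K := add_mem hc hs
  have hl0 : x 0 = ι ((1 + p 0) / 2) * (c + s) + ι ((1 - p 0) / 2) * (c + s)⁻¹ := by
    rw [h0, laurent hcs]
  have hl1 : x 1 = ι ((1 - q 1) / 2) * (c + s) + ι ((1 + q 1) / 2) * (c + s)⁻¹ := by
    have := laurent hcs (-q 1)
    rw [map_neg, sub_neg_eq_add, ← sub_eq_add_neg] at this
    rw [h1, ← this]; ring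
  have f0 := aeval_laurentQuartic_of_sq hz0 hl0 hw2
  have f1 := aeval_laurentQuartic_of_sq hz0 hl1 hB2
  have hp0 := h.p_pos 0
  have hq0 := h.q_pos 0
  have hp1 := h.p_pos 1
  have hq1 := h.q_pos 1
  rcases exists_sq_of_sq_mem (K := K) (B := B) (w := w)
    -- A field containing `K` and `B` contains `x 2`, then `x 3` as the common root of the relations
    -- of faces 2 and 3, and then `w`.
    (hB2 ▸ sub_mem (pow_mem hx1 2) (hι _)) (hw2 ▸ sub_mem (pow_mem hx0 2) (hι _)) (by
      intro M hKM hBM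
      have hx2 : x 2 ∈ M := hr1.mem_of_farCoord_mem hp1 (h.q_pos 2) (h.ne_zero 1) (hKM hx1) hBM
      have hx3 : x 3 ∈ M := hr3.mem_of_not_proportional hr2 hq0 (h.p_pos 3) (h.p_pos 2)
        (h.q_pos 3) (h.ne_zero 0) hne (hKM hx0) hx2
      exact farCoord_mem (hKM hx0) hx3) with hwK | ⟨hBK, hwB⟩
  · have hsq := isSquare_of_aeval_eq_sq hz (mul_mem hzK hwK) f0
    rcases eq_zero_or_of_isSquare_laurentQuartic (by positivity) hsq with e | e
    · left
      rw [← sq_eq_sq₀ hq0.le zero_le_one]; linarith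
    · right; left
      rw [← sq_eq_sq₀ hq0.le hp0.le]; linarith
  · by_cases hq01 : q 0 = 1
    · exact Or.inl hq01
    by_cases hq0p0 : q 0 = p 0
    · exact Or.inr (Or.inl hq0p0)
    refine Or.inr (Or.inr ?_)
    have hp1q1 : p 1 ≠ q 1 := fun e => hBK <| by
      rw [hB, (h.param_of_eq e hcs h1 hf).2]
      exact sub_mem (mul_mem (hι _) hc) hs
    have hp11 : p 1 ≠ 1 := fun e => hBK <| by
      rw [e] at hB2
      have : B ^ 2 = x 1 ^ 2 := by rw [hB2]; simp
      rcases sq_eq_sq_iff_eq_or_eq_neg.1 this with e | e <;> rw [e]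
      · exact hx1
      · exact neg_mem hx1
    have hsq : IsSquare (laurentQuartic ((1 + p 0) / 2) ((1 - p 0) / 2) (1 - q 0 ^ 2) *
        laurentQuartic ((1 - q 1) / 2) ((1 + q 1) / 2) (1 - p 1 ^ 2)) := by
      refine isSquare_of_aeval_eq_sq hz (w := (c + s) ^ 2 * (w * B))
        (mul_mem (pow_mem hzK 2) hwB) ?_
      rw [map_mul, f0, f1]; ring
    -- For positive parameters the two quartics cannot be proportional, so neither can be squarefree
    -- of degree four.
    have hne2 : (1 - q 1) ^ 2 * (1 - p 0) ^ 2 ≠ (1 + p 0) ^ 2 * (1 + q 1) ^ 2 := by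
      have : 0 < (2 * p 0 + 2 * q 1) * (2 + 2 * p 0 * q 1) := by positivity
      intro e
      linarith
    refine ⟨hp1q1, ?_, ?_⟩
    · by_contra hp01
      have hsf := squarefree_laurentQuartic (a := (1 + p 0) / 2) (b := (1 - p 0) / 2)
        (m := 1 - q 0 ^ 2) (fun e => hp01 (by linarith))
        (fun e => hq01 (by rw [← sq_eq_sq₀ hq0.le zero_le_one]; linarith))
        (fun e => hq0p0 (by rw [← sq_eq_sq₀ hq0.le hp0.le]; linarith))
      have := laurentQuartic_dvd (by positivity) (dvd_of_squarefree_of_isSquare_mul hsf hsq)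
      exact hne2 (by linarith)
    · by_contra hq11
      have hsf := squarefree_laurentQuartic (a := (1 - q 1) / 2) (b := (1 + q 1) / 2)
        (m := 1 - p 1 ^ 2) (by positivity)
        (fun e => hp11 (by rw [← sq_eq_sq₀ hp1.le zero_le_one]; linarith))
        (fun e => hp1q1 (by rw [← sq_eq_sq₀ hp1.le hq1.le]; linarith))
      have := laurentQuartic_dvd (fun e => hq11 (by linarith))
        (dvd_of_squarefree_of_isSquare_mul hsf (by rwa [mul_comm] at hsq))
      exact hne2 (by linarith)

/-- Equality at sides 0 and 1 lets the parameter of face 0 propagate both ways, to `x 3` and `x 2`;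
face 2 must then be the relation that this parametrization satisfies. -/
theorem eq_of_two_eq (h : ScalingCycle p q x) (h1 : p 1 = q 1) (h0 : q 0 = p 0) :
    p 2 = q 2 ∧ p 3 = q 3 := by
  obtain ⟨c, s, hcs, hz, e0, e1, hf⟩ := h.exists_param
  obtain ⟨e2, -⟩ := h.param_of_eq h1 hcs e1 hf
  have e3 := ((h.reflect 1).param_of_eq (c := c) (s := -s) h0 (by linear_combination hcs)
    (by change x 0 = c - ι (p 0) * -s; rw [e0]; ring) (by
      change farCoord (ι (p 0)) (ι (q 1)) (x 0) (x 1) = ι (p 0) * c - -s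
      have hn := algebraMap_add_ne_zero (L := L) (h.p_pos 0) (h.q_pos 1)
      unfold farCoord
      rw [e0, e1, div_eq_iff hn]; ring)).1
  replace e3 : x 3 = c - ι (p 3) * s := by
    change x 3 = c + ι (p 3) * -s at e3
    rw [e3]; ring
  have hr2 := h.rel 2
  simp only [Fin.reduceAdd] at hr2
  obtain ⟨e4, e5⟩ := face_params_eq (κ := 1) (q := p 3) hcs (transcendental_param hcs
    (e2 ▸ h.transcendental 2) ) e2 e3 (h.p_pos 3) (h.p_pos 2) (h.q_pos 3)
    (by rwa [map_one, one_mul])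
  rw [one_pow, one_mul, sq_eq_sq₀ (add_pos (h.p_pos 2) (h.q_pos 3)).le
    (add_pos (h.q_pos 2) (h.p_pos 3)).le] at e5
  exact ⟨by linarith, e4.symm⟩

/-- `params_cases` applied in both directions gives equality at a second side, so that
`eq_of_two_eq` finishes, or else `q 0 = p 2 = 1`. In the latter case faces 2 and 3 are linear in `x
3`; eliminating it gives an identity in `z` that forces `x 0 = x 2`. -/
theorem eq_of_one_eq (h : ScalingCycle p q x) (hne : ¬ ∃ κ : ℝ, x 2 = ι κ * x 0)
    (h1 : p 1 = q 1) : p = q := by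
  have : CharZero L := charZero_of_injective_algebraMap (algebraMap ℝ L).injective
  have hne' : ¬ ∃ κ : ℝ, x 0 = ι κ * x 2 := by
    rintro ⟨κ, hκ⟩
    have hκ0 : ι κ ≠ 0 := by
      intro h0
      rw [h0, zero_mul] at hκ
      exact h.ne_zero 0 hκ
    exact hne ⟨κ⁻¹, by rw [hκ, map_inv₀, inv_mul_cancel_left₀ hκ0]⟩
  have a1 : q 0 = 1 ∨ q 0 = p 0 := by
    rcases h.params_cases hne with e | e | ⟨e, -⟩
    exacts [Or.inl e, Or.inr e, absurd h1 e]
  have a2 : p 2 = 1 ∨ p 2 = q 2 := by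
    rcases (h.reflect 2).params_cases hne' with e | e | ⟨e, -⟩
    exacts [Or.inl e, Or.inr e, absurd h1.symm e]
  by_cases b1 : q 0 = p 0
  · obtain ⟨b2, b3⟩ := h.eq_of_two_eq h1 b1
    ext i
    fin_cases i
    exacts [b1.symm, h1, b2, b3]
  by_cases b2 : p 2 = q 2
  · obtain ⟨b0, b3⟩ := (h.reflect 2).eq_of_two_eq h1.symm b2
    change q 0 = p 0 at b0
    exact absurd b0 b1
  exfalso
  have a1 := a1.resolve_right b1
  have a2 := a2.resolve_right b2
  obtain ⟨c, s, hcs, hz, e0, e1, hf⟩ := h.exists_param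
  obtain ⟨e2, -⟩ := h.param_of_eq h1 hcs e1 hf
  have hr2 := h.rel 2
  have hr3 := h.rel 3
  simp only [Fin.reduceAdd] at hr2 hr3
  rw [a2] at hr2
  rw [a1] at hr3
  have f2 : 2 * x 2 * x 3 = ι (1 + q 3) - ι (q 3 - 1) * x 2 ^ 2 := by
    have hn : ι (q 3 + 1) ≠ 0 := by
      have := h.q_pos 3
      rw [_root_.map_ne_zero]; positivity
    apply mul_left_cancel₀ hn
    unfold AreaRel at hr2
    simp only [map_add, map_sub, map_one] at hr2 ⊢
    linear_combination hr2
  have f3 : 2 * x 0 * x 3 = ι (1 + p 3) - ι (p 3 - 1) * x 0 ^ 2 := by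
    have hn : ι (p 3 + 1) ≠ 0 := by
      have := h.p_pos 3
      rw [_root_.map_ne_zero]; positivity
    apply mul_left_cancel₀ hn
    unfold AreaRel at hr3
    simp only [map_add, map_sub, map_one] at hr3 ⊢
    linear_combination hr3
  have key : x 2 * (ι (1 + p 3) - ι (p 3 - 1) * x 0 ^ 2) =
      x 0 * (ι (1 + q 3) - ι (q 3 - 1) * x 2 ^ 2) := by
    rw [← f2, ← f3]; ring
  have hz' : Transcendental ℝ (c + s)⁻¹ := fun h => hz (by simpa using h.inv)
  have l0 := laurent hcs (p 0)
  have l2 := laurent hcs (q 2)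
  rw [← e0] at l0
  rw [← e2] at l2
  have g1 := mul_sq_eq_of_laurent_identity hz l0 l2 key
  -- Replacing `z` by `z⁻¹` gives the coefficient at the opposite end.
  have g2 := mul_sq_eq_of_laurent_identity hz' (by rw [inv_inv, add_comm]; exact l0)
    (by rw [inv_inv, add_comm]; exact l2) key
  have c0 : (1 - p 0) / 2 ≠ 0 := fun e => b1 (by linarith)
  have c2 : (1 - q 2) / 2 ≠ 0 := fun e => b2 (by linarith)
  have c0' : (1 + p 0) / 2 ≠ 0 := by have := h.p_pos 0; positivity
  have c2' : (1 + q 2) / 2 ≠ 0 := by have := h.q_pos 2; positivity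
  have g1' : (1 - p 0) / 2 * (1 - p 3) = (1 - q 2) / 2 * (1 - q 3) := by
    apply mul_left_cancel₀ (mul_ne_zero c0 c2); linarith
  have g2' : (1 + p 0) / 2 * (1 - p 3) = (1 + q 2) / 2 * (1 - q 3) := by
    apply mul_left_cancel₀ (mul_ne_zero c0' c2'); linarith
  have g3 : p 3 = q 3 := by linarith
  rw [← g3] at g2' f2
  by_cases g4 : p 3 = 1
  · apply hne
    refine ⟨1, ?_⟩
    rw [g4] at f2 f3
    simp only [sub_self, map_zero, zero_mul] at f2 f3
    rw [map_one, one_mul]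
    apply mul_right_cancel₀ (h.ne_zero 3)
    linear_combination (f2 - f3) / 2
  · have : (1 + p 0) / 2 = (1 + q 2) / 2 :=
      mul_right_cancel₀ (sub_ne_zero.2 (Ne.symm g4)) g2'
    have : p 0 = q 2 := by linarith
    exact hne ⟨1, by rw [map_one, one_mul, e0, e2, this]⟩

/-- Here faces 0 and 2 become `x 0 * x 1 = 1` and `x 2 * x 3 = 1`, so face 3 turns into an equation
between `x 1` and `x 2`, both parametrized by face 1. The constant coefficient of that equation in
`z⁻¹` gives the claim. -/
theorem not_alternating (h : ScalingCycle p q x) (h0 : p 0 = 1) (h1 : q 1 = 1) (h2 : p 2 = 1)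
    (h3 : q 3 = 1) : q 2 = 1 := by
  have hr0 := h.rel 0
  have hr1 := h.rel 1
  have hr2 := h.rel 2
  have hr3 := h.rel 3
  simp only [Fin.reduceAdd, zero_add] at hr0 hr1 hr2 hr3
  have : CharZero L := charZero_of_injective_algebraMap (algebraMap ℝ L).injective
  have e01 : x 0 * x 1 = 1 := by
    rw [h0, h1, map_one] at hr0
    unfold AreaRel at hr0
    linear_combination hr0 / 4
  have e23 : x 2 * x 3 = 1 := by
    rw [h2, h3, map_one] at hr2
    unfold AreaRel at hr2
    linear_combination hr2 / 4
  obtain ⟨c, s, hcs, f1, f2, -⟩ := hr1.exists_param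
    (algebraMap_add_ne_zero (h.p_pos 1) (h.q_pos 2))
  have hz := transcendental_param hcs (f1 ▸ h.transcendental 1)
  have hz' : Transcendental ℝ (c + s)⁻¹ := fun h => hz (by simpa using h.inv)
  have hz0 : c + s ≠ 0 := fun h0 => hz (h0 ▸ isAlgebraic_zero)
  have l1 := laurent hcs (p 1)
  have l2 := laurent hcs (-q 2)
  rw [← f1] at l1
  rw [map_neg, neg_mul, ← sub_eq_add_neg, ← f2, sub_neg_eq_add, ← sub_eq_add_neg] at l2
  set a := (1 + p 1) / 2
  set b := (1 - p 1) / 2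
  set a' := (1 - q 2) / 2 with ha'
  set b' := (1 + q 2) / 2
  set y := (c + s)⁻¹ with hy
  have hy0 : y ≠ 0 := inv_ne_zero hz0
  have m1 : ι a + ι b * y ^ 2 = y * x 1 := by rw [l1, hy]; field_simp
  have m2 : ι a' + ι b' * y ^ 2 = y * x 2 := by rw [l2, hy]; field_simp
  have key : aeval y (X ^ 2 * ((C (q 0) * (C a + C b * X ^ 2) + C (p 3) * (C a' + C b' * X ^ 2)) ^ 2
      - ((C a + C b * X ^ 2) - (C a' + C b' * X ^ 2)) ^ 2) - C ((p 3 + q 0) ^ 2) *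
      (C a + C b * X ^ 2) ^ 2 * (C a' + C b' * X ^ 2) ^ 2 : ℝ[X]) = 0 := by
    simp only [map_sub, map_mul, map_pow, aeval_C, aeval_X, map_add]
    rw [m1, m2]
    unfold AreaRel at hr3
    have n1 : x 3 * (x 1 * x 2) = x 1 := by linear_combination x 1 * e23
    have n2 : x 0 * (x 1 * x 2) = x 2 := by linear_combination x 2 * e01
    have : (ι (q 0) * x 1 + ι (p 3) * x 2) ^ 2 - (x 1 - x 2) ^ 2 =
        (ι (p 3) + ι (q 0)) ^ 2 * (x 1 * x 2) ^ 2 := by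
      have n3 : ι (q 0) * x 1 + ι (p 3) * x 2 =
          (ι (q 0) * x 3 + ι (p 3) * x 0) * (x 1 * x 2) := by
        linear_combination -ι (q 0) * n1 - ι (p 3) * n2
      have n4 : x 1 - x 2 = (x 3 - x 0) * (x 1 * x 2) := by linear_combination n2 - n1
      rw [← hr3, n3]
      nth_rewrite 1 [n4]
      ring
    linear_combination y ^ 4 * this
  have k0 := eval_eq_zero_of_transcendental hz' key 0
  simp at k0
  have : a ≠ 0 := by have := h.p_pos 1; positivity
  have hs : p 3 + q 0 ≠ 0 := (add_pos (h.p_pos 3) (h.q_pos 0)).ne'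
  have : a' = 0 := by tauto
  rw [ha'] at this
  linarith

theorem classification (h : ScalingCycle p q x) :
    (q 1 = p 1 ∧ p 0 = q 2 ∧ p 2 = q 0 ∧ p 3 = q 3) ∨
    (q 2 = p 2 ∧ p 1 = q 3 ∧ p 3 = q 1 ∧ p 0 = q 0) ∨ p = q := by
  by_cases h02 : ∃ κ : ℝ, x 2 = ι κ * x 0
  · exact Or.inl (h.eq_of_proportional h02.choose_spec)
  by_cases h13 : ∃ κ : ℝ, x 3 = ι κ * x 1
  · exact Or.inr (Or.inl ((h.rotate 1).eq_of_proportional h13.choose_spec))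
  refine Or.inr (Or.inr ?_)
  have hinv : ∀ i j, (¬ ∃ κ : ℝ, x i = ι κ * x j) → ¬ ∃ κ : ℝ, x j = ι κ * x i := by
    rintro i j hne ⟨κ, hκ⟩
    have hκ0 : ι κ ≠ 0 := by
      intro h0
      rw [h0, zero_mul] at hκ
      exact h.ne_zero j hκ
    exact hne ⟨κ⁻¹, by rw [hκ, map_inv₀, inv_mul_cancel_left₀ hκ0]⟩
  have hprop : ∀ i, ¬ ∃ κ : ℝ, x (i + 2) = ι κ * x i := by
    intro i
    fin_cases i
    exacts [h02, h13, hinv _ _ h02, hinv _ _ h13]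
  by_contra hpq
  have hne : ∀ i, p i ≠ q i := by
    intro i hi
    apply hpq
    have := (h.rotate (i - 1)).eq_of_one_eq (by
      simp only [zero_add, add_comm 2 (i - 1)]
      exact hprop (i - 1)) (by
      rwa [add_sub_cancel])
    ext j
    have := congrFun this (j - (i - 1))
    simpa using this
  -- With `p i ≠ q i` everywhere, the remaining cases of `params_cases` propagate round the cycle as
  -- an alternating pattern of ones, to which `not_alternating` applies directly or after a
  -- rotation.
  have alt : ∀ i, (q i = 1 ∧ p (i + 1) = 1) ∨ (p i = 1 ∧ q (i + 1) = 1) := by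
    intro i
    have a1 := (h.rotate i).params_cases (by
      simp only [zero_add, add_comm 2 i]
      exact hprop i)
    have a2 := (h.reflect (i + 1)).params_cases (by
      simp only [sub_zero]
      have := hinv _ _ (hprop (i - 1))
      have e : ∀ i : Fin 4, i - 1 + 2 = i + 1 := by decide
      have e' : ∀ i : Fin 4, i + 1 - 2 = i - 1 := by decide
      rwa [e, ← e'] at this)
    simp only [zero_add, sub_zero, add_sub_cancel_right, add_comm 1 i] at a1 a2
    have := hne i
    have := hne (i + 1)
    tauto
  have g0 := alt 0
  have g1 := alt 1
  have g2 := alt 2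
  have g3 := alt 3
  simp only [Fin.reduceAdd, zero_add] at g0 g1 g2 g3
  have := hne 0
  have := hne 1
  have := hne 2
  have := hne 3
  have n0 := h.not_alternating
  have n1 := (h.rotate 1).not_alternating
  simp only [Fin.reduceAdd, zero_add] at n0 n1
  grind

end ScalingCycle
end ScalingCycle

/-! ### From infinitely many real solutions to a transcendental one -/

section SequenceOfSolutions
open Polynomial Filter

/-- Even if `p = 1`, the polynomial in `y` is nonzero: its linear coefficient is positive. -/
theorem finite_setOf_areaRel {p q x : ℝ} (hp : 0 < p) (hq : 0 < q) (hx : 0 < x) :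
    {y | AreaRel p q x y}.Finite := by
  set f : ℝ[X] := C (p ^ 2 - 1) * X ^ 2 + C (2 * (p * q + 1) * x) * X +
    C ((q ^ 2 - 1) * x ^ 2 - (p + q) ^ 2) with hf
  have hf0 : f ≠ 0 := by
    intro h0
    have h1 : f.coeff 1 = 0 := by rw [h0, coeff_zero]
    have h2 : f.coeff 1 = 2 * (p * q + 1) * x := by
      rw [hf]
      simp only [coeff_add, coeff_C_mul, coeff_X_pow, coeff_X, coeff_C]
      norm_num
    rw [h2] at h1
    have : 0 < 2 * (p * q + 1) * x := by positivity
    exact this.ne' h1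
  refine (f.roots.toFinset.finite_toSet).subset ?_
  intro y hy
  rw [Finset.mem_coe, Multiset.mem_toFinset, mem_roots hf0, IsRoot, hf]
  simp only [eval_add, eval_mul, eval_C, eval_pow, eval_X]
  have : AreaRel p q x y := hy
  unfold AreaRel at this
  linarith

/-- Fixing one coordinate leaves finitely many values for the next, and so on round the cycle. -/
theorem finite_setOf_coord_eq {p q : Fin 4 → ℝ} (hp : ∀ i, 0 < p i) (hq : ∀ i, 0 < q i)
    {X : ℕ → Fin 4 → ℝ} (hX : Function.Injective X) (hpos : ∀ n i, 0 < X n i)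
    (hrel : ∀ n i, AreaRel (p i) (q (i + 1)) (X n i) (X n (i + 1))) (i : Fin 4) (v : ℝ) :
    {n | X n i = v}.Finite := by
  set N := {n | X n i = v}
  have step : ∀ j, ((fun n => X n j) '' N).Finite → ((fun n => X n (j + 1)) '' N).Finite := by
    intro j ih
    refine (ih.biUnion (t := fun w => {y | 0 < w ∧ AreaRel (p j) (q (j + 1)) w y})
      fun w _ => ?_).subset ?_
    · by_cases hw : 0 < w
      · exact (finite_setOf_areaRel (hp _) (hq _) hw).subset fun y hy => hy.2
      · simp [hw]
    · rintro _ ⟨n, hn, rfl⟩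
      exact Set.mem_biUnion (Set.mem_image_of_mem _ hn) ⟨hpos n _, hrel n j⟩
  have h0 : ((fun n => X n i) '' N).Finite := by
    refine (Set.finite_singleton v).subset ?_
    rintro _ ⟨n, hn, rfl⟩
    exact hn
  have hfin : (X '' N).Finite := by
    refine (Set.Finite.pi (t := fun j => (fun n => X n j) '' N) fun j => ?_).subset ?_
    · have : ∀ i j : Fin 4, j = i ∨ j = i + 1 ∨ j = i + 1 + 1 ∨ j = i + 1 + 1 + 1 := by decide
      rcases this i j with rfl | rfl | rfl | rfl
      exacts [h0, step _ h0, step _ (step _ h0), step _ (step _ (step _ h0))]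
    · rintro _ ⟨n, hn, rfl⟩ j -
      exact ⟨n, hn, rfl⟩
  exact hfin.of_finite_image hX.injOn

/-- Infinitely many positive solutions of the area relations yield a transcendental solution in a
field of germs of sequences. -/
theorem classification_of_sequence {p q : Fin 4 → ℝ} (hp : ∀ i, 0 < p i) (hq : ∀ i, 0 < q i)
    {X : ℕ → Fin 4 → ℝ} (hX : Function.Injective X) (hpos : ∀ n i, 0 < X n i)
    (hrel : ∀ n i, AreaRel (p i) (q (i + 1)) (X n i) (X n (i + 1)))
    (hfar : ∀ n i, 0 < farCoord (p i) (q (i + 1)) (X n i) (X n (i + 1)))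
    (hfar' : ∀ n i, 0 < farCoord (q (i + 1)) (p i) (X n (i + 1)) (X n i)) :
    (q 1 = p 1 ∧ p 0 = q 2 ∧ p 2 = q 0 ∧ p 3 = q 3) ∨
    (q 2 = p 2 ∧ p 1 = q 3 ∧ p 3 = q 1 ∧ p 0 = q 0) ∨ p = q := by
  -- The germs form a hyperreal field. A coordinate is transcendental there because it takes each
  -- real value, in particular each root of a given polynomial, only finitely often.
  let φ : Filter ℕ := hyperfilter ℕ
  let π : (ℕ → ℝ) →+* Germ φ ℝ := Germ.coeRingHom φ
  let _ : Algebra ℝ (Germ φ ℝ) := (π.comp (Pi.constRingHom ℕ ℝ)).toAlgebra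
  have hπ : ∀ f : ℕ → ℝ, π f = 0 → ∀ᶠ n in φ, f n = 0 := fun f hf => Germ.coe_eq.1 hf
  have hcyc : ScalingCycle (L := Germ φ ℝ) p q (fun i => π fun n => X n i) := by
    refine ⟨hp, hq, ?_, ?_, ?_⟩
    · intro i
      rw [transcendental_iff]
      intro f hf
      have haev : aeval (π fun n => X n i) f = π fun n => f.eval (X n i) := by
        have e : (fun n => f.eval (X n i)) = f.eval₂ (Pi.constRingHom ℕ ℝ) fun n => X n i := by
          ext n
          have := hom_eval₂ f (Pi.constRingHom ℕ ℝ) (Pi.evalRingHom (fun _ : ℕ => ℝ) n)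
            fun n => X n i
          exact this.symm
        rw [e, hom_eval₂]
        rfl
      rw [haev] at hf
      by_contra hf0
      have hfin : {n | f.eval (X n i) = 0}.Finite := by
        refine (f.roots.toFinset.finite_toSet.biUnion (t := fun v => {n | X n i = v})
          fun v _ => finite_setOf_coord_eq hp hq hX hpos hrel i v).subset ?_
        intro n hn
        refine Set.mem_biUnion (x := X n i) ?_ rfl
        rw [Finset.mem_coe, Multiset.mem_toFinset, mem_roots hf0]
        exact hn
      exact Filter.notMem_hyperfilter_of_finite hfin (hπ _ hf)
    · intro i
      have := congrArg π (show (fun n => (q (i + 1) * X n i + p i * X n (i + 1)) ^ 2 -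
        (X n i - X n (i + 1)) ^ 2) = fun n => (p i + q (i + 1)) ^ 2 from
          funext fun n => hrel n i)
      exact this
    · intro i h0
      have h1 : π (fun n => farCoord (p (i + 1)) (q (i + 2)) (X n (i + 1)) (X n (i + 2)) +
        farCoord (q (i + 1)) (p i) (X n (i + 1)) (X n i)) = 0 := h0
      obtain ⟨n, hn⟩ := (hπ _ h1).exists
      have := hfar n (i + 1)
      have := hfar' n i
      rw [show i + 1 + 1 = i + 2 by rw [add_assoc]; rfl] at *
      linarith
  exact hcyc.classification

end SequenceOfSolutions

/-! ### Affine coordinates of a single face -/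

section Face

variable {d : ℕ}

local notation "𝔼" => EuclideanSpace ℝ (Fin d)

/-- `OABC` is a convex quadrilateral whose vertex `B` has coordinates `l`, `m` with respect to
the origin `O` and the sides `OA`, `OC`. -/
structure IsFace (O A B C : EuclideanSpace ℝ (Fin d)) (l m : ℝ) : Prop where
  indep : LinearIndependent ℝ ![A - O, C - O]
  l_pos : 0 < l
  m_pos : 0 < m
  one_lt : 1 < l + m
  eq : B - O = l • (A - O) + m • (C - O)

theorem not_collinear_of_det_ne_zero {a c P Q R : 𝔼} (h : LinearIndependent ℝ ![a, c])
    {x y x' y' : ℝ} (hQ : Q - P = x • a + y • c) (hR : R - P = x' • a + y' • c)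
    (hdet : x * y' - x' * y ≠ 0) : ¬ Collinear ℝ {P, Q, R} := by
  rw [collinear_iff_of_mem (p₀ := P) (by simp)]
  rintro ⟨v, hv⟩
  obtain ⟨r, hr⟩ := hv Q (by simp)
  obtain ⟨r', hr'⟩ := hv R (by simp)
  have e1 : Q - P = r • v := by rw [hr]; simp
  have e2 : R - P = r' • v := by rw [hr']; simp
  have e3 : (r' * x) • a + (r' * y) • c = (r * x') • a + (r * y') • c := by
    rw [mul_smul, mul_smul, mul_smul, mul_smul, ← smul_add, ← smul_add, ← hQ, ← hR, e1, e2,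
      smul_comm]
  obtain ⟨h1, h2⟩ := h.eq_of_pair e3
  have hr0 : r = 0 := by
    have : r * (x * y' - x' * y) = 0 := by linear_combination y * h1 - x * h2
    exact (mul_eq_zero.1 this).resolve_right hdet
  rw [hr0, zero_smul, hQ] at e1
  obtain ⟨h3, h4⟩ := h.eq_of_pair (s' := 0) (t' := 0) (by simpa using e1)
  rw [h3, h4] at hdet
  simp at hdet

/-- Equating the two expressions for the diagonal point, with ratio `t` on `OB` and `u` on `AC`,
gives the coordinates `(1 - u) / t` and `u / t` of `B`, whose sum is `1 / t > 1`. -/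
theorem IsConvexQuad.exists_isFace {O A B C : 𝔼} (h : IsConvexQuad O A B C) :
    ∃ l m, IsFace O A B C l m := by
  obtain ⟨hcol, Q, hOB, hAC⟩ := h
  obtain ⟨⟨t, ⟨ht0, ht1⟩, hQ⟩, -⟩ := sbtw_iff_mem_image_Ioo_and_ne.1 hOB
  obtain ⟨⟨u, ⟨hu0, hu1⟩, hQ'⟩, -⟩ := sbtw_iff_mem_image_Ioo_and_ne.1 hAC
  rw [AffineMap.lineMap_apply_module'] at hQ hQ'
  have e : t • (B - O) = (1 - u) • (A - O) + u • (C - O) := by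
    have : t • (B - O) = u • (C - A) + A - O := by rw [hQ', ← hQ]; abel
    rw [this]; module
  have e' : B - O = ((1 - u) / t) • (A - O) + (u / t) • (C - O) := by
    have : B - O = t⁻¹ • t • (B - O) := by rw [smul_smul, inv_mul_cancel₀ ht0.ne', one_smul]
    rw [this, e]
    module
  refine ⟨(1 - u) / t, u / t, ?_, ?_, ?_, ?_, e'⟩
  · rw [LinearIndependent.pair_iff]
    intro s r hsr
    by_contra hne
    apply hcol
    rw [collinear_iff_of_mem (p₀ := O) (by simp)]
    by_cases hr : r = 0
    · have hs : s ≠ 0 := fun hs => hne ⟨hs, hr⟩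
      have hA : A - O = 0 := by
        rw [hr, zero_smul, add_zero] at hsr
        exact (smul_eq_zero.1 hsr).resolve_left hs
      refine ⟨B - O, ?_⟩
      rintro P (rfl | rfl | rfl)
      · exact ⟨0, by simp⟩
      · exact ⟨0, by simpa using sub_eq_zero.1 hA⟩
      · exact ⟨1, by simp⟩
    · have hC : C - O = (-(s / r)) • (A - O) := by
        have : r • (C - O) = (-s) • (A - O) := by
          rw [neg_smul, eq_neg_iff_add_eq_zero, add_comm, hsr]
        have h2 : C - O = r⁻¹ • r • (C - O) := by
          rw [smul_smul, inv_mul_cancel₀ hr, one_smul]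
        rw [h2, this]
        module
      refine ⟨A - O, ?_⟩
      rintro P (rfl | rfl | rfl)
      · exact ⟨0, by simp⟩
      · exact ⟨1, by simp⟩
      · refine ⟨(1 - u) / t - u / t * (s / r), ?_⟩
        rw [vadd_eq_add, ← sub_eq_iff_eq_add, e', hC]
        module
  · exact div_pos (by linarith) ht0
  · exact div_pos hu0 ht0
  · rw [← add_div, lt_div_iff₀ ht0]; linarith

namespace IsFace

variable {O A B C : EuclideanSpace ℝ (Fin d)} {l m : ℝ}

theorem swap (h : IsFace O A B C l m) : IsFace O C B A m l where
  indep := LinearIndependent.pair_symm_iff.1 h.indep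
  l_pos := h.m_pos
  m_pos := h.l_pos
  one_lt := by rw [add_comm]; exact h.one_lt
  eq := by rw [h.eq, add_comm]

theorem crossing (h : IsFace O A B C l m) :
    (l + m)⁻¹ • (B - O) + O = (m / (l + m)) • (C - A) + A := by
  have hs : l + m ≠ 0 := by have := h.one_lt; positivity
  have e1 : (l + m)⁻¹ * l = 1 - m / (l + m) := by field_simp; ring
  have e2 : (l + m)⁻¹ * m = m / (l + m) := by field_simp
  rw [h.eq, smul_add, smul_smul, smul_smul, e1, e2]
  module

theorem isConvexQuad (h : IsFace O A B C l m) : IsConvexQuad O A B C := by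
  have h1 := h.one_lt
  have hl := h.l_pos
  have hm := h.m_pos
  refine ⟨not_collinear_of_det_ne_zero h.indep (x := 1) (y := 0) (by simp) h.eq (by simpa using
    hm.ne'), (l + m)⁻¹ • (B - O) + O, ?_, ?_⟩
  · rw [sbtw_iff_mem_image_Ioo_and_ne]
    refine ⟨⟨(l + m)⁻¹, ⟨by positivity, inv_lt_one_of_one_lt₀ h1⟩, ?_⟩, ?_⟩
    · rw [AffineMap.lineMap_apply_module']
    · rintro rfl
      have := h.eq
      rw [sub_self] at this
      obtain ⟨h3, -⟩ := h.indep.eq_of_pair (s := 0) (t := 0) (by simpa using this)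
      exact hl.ne h3
  · rw [sbtw_iff_mem_image_Ioo_and_ne, h.crossing]
    refine ⟨⟨m / (l + m), ⟨by positivity, ?_⟩, ?_⟩, ?_⟩
    · rw [div_lt_one (by positivity)]; linarith
    · rw [AffineMap.lineMap_apply_module']
    · rintro rfl
      obtain ⟨h3, -⟩ := h.indep.eq_of_pair (s := 1) (t := 0) (s' := 0) (t' := 1) (by simp)
      exact one_ne_zero h3

end IsFace

theorem IsConvexQuad.rotate {A B C D : 𝔼} (h : IsConvexQuad A B C D) :
    IsConvexQuad B C D A := by
  obtain ⟨l, m, hf⟩ := h.exists_isFace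
  obtain ⟨-, Q, h1, h2⟩ := h
  refine ⟨not_collinear_of_det_ne_zero hf.indep (x := l - 1) (y := m) (x' := -1) (y' := 1)
    ?_ ?_ ?_, Q, h2, h1.symm⟩
  · rw [show C - B = (C - A) - (B - A) by abel, hf.eq]
    module
  · module
  · have := hf.one_lt
    intro h0; linarith

/-- The area of the parallelogram spanned by two vectors. -/
noncomputable def parallelogramArea (a c : 𝔼) : ℝ :=
  √(inner ℝ a a * inner ℝ c c - inner ℝ a c * inner ℝ a c)

theorem parallelogramArea_pos {a c : 𝔼} (h : LinearIndependent ℝ ![a, c]) :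
    0 < parallelogramArea a c := by
  apply Real.sqrt_pos.2
  have ha : a ≠ 0 := h.ne_zero 0
  have haa : 0 < inner ℝ a a := real_inner_self_pos.2 ha
  have hv : (-inner ℝ a c) • a + inner ℝ a a • c ≠ 0 := fun h0 =>
    haa.ne' ((LinearIndependent.pair_iff.1 h _ _ h0).2)
  have := real_inner_self_pos.2 hv
  simp only [inner_add_left, inner_add_right, real_inner_smul_left, real_inner_smul_right,
    real_inner_comm a c] at this
  refine pos_of_mul_pos_right ?_ haa.le
  linarith

theorem triangleArea_eq {a c P Q R : 𝔼} {x y x' y' : ℝ} (hQ : Q - P = x • a + y • c)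
    (hR : R - P = x' • a + y' • c) :
    triangleArea P Q R = |x * y' - x' * y| / 2 * parallelogramArea a c := by
  have h1 := InnerProductGeometry.sin_angle_mul_norm_mul_norm (Q - P) (R - P)
  have h2 : inner ℝ (Q - P) (Q - P) * inner ℝ (R - P) (R - P) -
      inner ℝ (Q - P) (R - P) * inner ℝ (Q - P) (R - P) =
      (x * y' - x' * y) ^ 2 * (inner ℝ a a * inner ℝ c c - inner ℝ a c * inner ℝ a c) := by
    rw [hQ, hR]
    simp only [inner_add_left, inner_add_right, real_inner_smul_left, real_inner_smul_right,
      real_inner_comm a c]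
    ring
  rw [h2, Real.sqrt_mul (sq_nonneg _), Real.sqrt_sq_eq_abs] at h1
  rw [triangleArea, dist_comm P Q, dist_comm P R, dist_eq_norm, dist_eq_norm, EuclideanGeometry.angle,
    vsub_eq_sub, vsub_eq_sub, parallelogramArea]
  linarith

theorem parallelogramArea_smul {a c : 𝔼} {x y : ℝ} (hx : 0 < x) (hy : 0 < y) :
    parallelogramArea (x • a) (y • c) = x * y * parallelogramArea a c := by
  unfold parallelogramArea
  simp only [real_inner_smul_left, real_inner_smul_right]
  nth_rewrite 1 [← Real.sqrt_sq (mul_pos hx hy).le]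
  rw [← Real.sqrt_mul (sq_nonneg _)]
  congr 1
  ring

namespace IsFace

variable {O A B C : EuclideanSpace ℝ (Fin d)} {l m : ℝ}

theorem parallelogramArea_pos (h : IsFace O A B C l m) :
    0 < parallelogramArea (A - O) (C - O) := _root_.parallelogramArea_pos h.indep

theorem quadArea_eq (h : IsFace O A B C l m) :
    quadArea O A B C = (l + m) / 2 * parallelogramArea (A - O) (C - O) := by
  have hl := h.l_pos
  have hm := h.m_pos
  rw [quadArea, triangleArea_eq (a := A - O) (c := C - O) (x := 1) (y := 0) (by simp) h.eq,
    triangleArea_eq h.eq (x' := 0) (y' := 1) (by simp)]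
  simp [abs_of_pos hl, abs_of_pos hm]
  ring

theorem quadArea_rotate (h : IsFace O A B C l m) :
    quadArea A B C O = (l + m) / 2 * parallelogramArea (A - O) (C - O) := by
  have h1 := h.one_lt
  have hB : B - A = (l - 1) • (A - O) + m • (C - O) := by
    rw [show B - A = (B - O) - (A - O) by abel, h.eq]; module
  have hC : C - A = (-1 : ℝ) • (A - O) + (1 : ℝ) • (C - O) := by module
  rw [quadArea, triangleArea_eq hB hC,
    triangleArea_eq hC (x' := -1) (y' := 0) (by module)]
  rw [abs_of_pos (by linarith), abs_of_pos (by norm_num)]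
  ring

theorem eq_crossing (h : IsFace O A B C l m) {Q : 𝔼} (h1 : Q ∈ segment ℝ O B)
    (h2 : Q ∈ segment ℝ A C) : Q = (l + m)⁻¹ • (B - O) + O := by
  have hs : l + m ≠ 0 := by have := h.one_lt; positivity
  rw [segment_eq_image'] at h1 h2
  obtain ⟨t, -, rfl⟩ := h1
  obtain ⟨u, -, hu⟩ := h2
  have e : (t * l) • (A - O) + (t * m) • (C - O) = (1 - u) • (A - O) + u • (C - O) := by
    rw [mul_smul, mul_smul, ← smul_add, ← h.eq, eq_comm]
    have : t • (B - O) = A + u • (C - A) - O := by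
      simp only at hu; rw [hu]; abel
    rw [this]; module
  obtain ⟨e1, e2⟩ := h.indep.eq_of_pair e
  have : t = (l + m)⁻¹ := by field_simp; linarith
  subst this
  exact add_comm _ _

theorem crossing_mem (h : IsFace O A B C l m) :
    (l + m)⁻¹ • (B - O) + O ∈ segment ℝ O B ∧ (l + m)⁻¹ • (B - O) + O ∈ segment ℝ A C := by
  have h1 := h.one_lt
  have hl := h.l_pos
  have hm := h.m_pos
  rw [segment_eq_image', segment_eq_image']
  refine ⟨⟨(l + m)⁻¹, ⟨by positivity, inv_le_one_of_one_le₀ h1.le⟩, add_comm _ _⟩, ?_⟩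
  rw [h.crossing]
  refine ⟨m / (l + m), ⟨by positivity, ?_⟩, add_comm _ _⟩
  rw [div_le_one (by positivity)]; linarith

theorem diagonalPoint_eq (h : IsFace O A B C l m) :
    diagonalPoint O A B C = (l + m)⁻¹ • (B - O) + O := by
  have := Classical.epsilon_spec (p := fun Q => Q ∈ segment ℝ O B ∧ Q ∈ segment ℝ A C)
    ⟨_, h.crossing_mem⟩
  exact h.eq_crossing this.1 this.2

theorem diagonalPoint_eq' (h : IsFace O A B C l m) :
    diagonalPoint A O C B = (l + m)⁻¹ • (B - O) + O := by
  have := Classical.epsilon_spec (p := fun Q => Q ∈ segment ℝ A C ∧ Q ∈ segment ℝ O B)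
    ⟨_, h.crossing_mem.symm⟩
  exact h.eq_crossing this.2 this.1

theorem oppositeRatio_eq (h : IsFace O A B C l m) :
    oppositeRatio O A B C = m / (l * (l + m - 1)) := by
  have h1 := h.one_lt
  have hl := h.l_pos
  have hm := h.m_pos
  have hg := h.parallelogramArea_pos
  have hs : 0 < l + m := by positivity
  have hs1 : 0 < l + m - 1 := by linarith
  rw [oppositeRatio, h.diagonalPoint_eq]
  set Q := (l + m)⁻¹ • (B - O) + O with hQ
  have hQO : Q - O = (l / (l + m)) • (A - O) + (m / (l + m)) • (C - O) := by
    rw [hQ, add_sub_cancel_right, h.eq]; module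
  have hQB : Q - B = (l / (l + m) - l) • (A - O) + (m / (l + m) - m) • (C - O) := by
    rw [show Q - B = (Q - O) - (B - O) by abel, hQO, h.eq]; module
  have hCB : C - B = (-l) • (A - O) + (1 - m) • (C - O) := by
    rw [show C - B = (C - O) - (B - O) by abel, h.eq]; module
  rw [triangleArea_eq hQO (x' := 1) (y' := 0) (by simp), triangleArea_eq hQB hCB]
  have e1 : |l / (l + m) * 0 - 1 * (m / (l + m))| = m / (l + m) := by
    rw [mul_zero, zero_sub, one_mul, abs_neg, abs_of_pos (by positivity)]
  have e2 : |(l / (l + m) - l) * (1 - m) - -l * (m / (l + m) - m)| =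
      l * (l + m - 1) / (l + m) := by
    rw [← abs_neg, ← abs_of_pos (show 0 < l * (l + m - 1) / (l + m) by positivity)]
    congr 1
    field_simp
    ring
  rw [e1, e2]
  field_simp

theorem oppositeRatio_eq' (h : IsFace O A B C l m) :
    oppositeRatio A O C B = m / (l * (l + m - 1)) := by
  have h1 := h.one_lt
  have hl := h.l_pos
  have hm := h.m_pos
  have hg := h.parallelogramArea_pos
  have hs : 0 < l + m := by positivity
  have hs1 : 0 < l + m - 1 := by linarith
  rw [oppositeRatio, h.diagonalPoint_eq']
  set Q := (l + m)⁻¹ • (B - O) + O with hQ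
  have hQO : Q - O = (l / (l + m)) • (A - O) + (m / (l + m)) • (C - O) := by
    rw [hQ, add_sub_cancel_right, h.eq]; module
  have hQA : Q - A = (l / (l + m) - 1) • (A - O) + (m / (l + m)) • (C - O) := by
    rw [show Q - A = (Q - O) - (A - O) by abel, hQO]; module
  have hQC : Q - C = (l / (l + m)) • (A - O) + (m / (l + m) - 1) • (C - O) := by
    rw [show Q - C = (Q - O) - (C - O) by abel, hQO]; module
  have hBC : B - C = l • (A - O) + (m - 1) • (C - O) := by
    rw [show B - C = (B - O) - (C - O) by abel, h.eq]; module
  rw [triangleArea_eq hQA (x' := -1) (y' := 0) (by module), triangleArea_eq hQC hBC]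
  have e1 : |(l / (l + m) - 1) * 0 - -1 * (m / (l + m))| = m / (l + m) := by
    rw [← abs_of_pos (show 0 < m / (l + m) by positivity)]
    congr 1
    rw [abs_of_pos (by positivity)]; ring
  have e2 : |l / (l + m) * (m - 1) - l * (m / (l + m) - 1)| = l * (l + m - 1) / (l + m) := by
    rw [← abs_of_pos (show 0 < l * (l + m - 1) / (l + m) by positivity)]
    congr 1
    field_simp
    ring
  rw [e1, e2]
  field_simp

/-- An affine map preserves the coordinates of the far vertex in the frame of the two sides at `O`,
and these coordinates are the only invariant. -/
theorem affineSymmetric_iff {B' C' : 𝔼} {l' m' : ℝ} (h : IsFace O A B C l m)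
    (h' : IsFace O A B' C' l' m') :
    (∃ φ : 𝔼 →ᵃ[ℝ] 𝔼, φ O = O ∧ φ A = A ∧ φ C = C' ∧ φ B = B') ↔ l = l' ∧ m = m' := by
  constructor
  · rintro ⟨φ, hO, hA, hC, hB⟩
    have key : ∀ P, φ P - O = φ.linear (P - O) := fun P => by
      rw [← vsub_eq_sub P O, AffineMap.linearMap_vsub, hO, vsub_eq_sub]
    have e := key B
    rw [h.eq, map_add, map_smul, map_smul, ← key, ← key, hA, hB, hC, h'.eq] at e
    obtain ⟨e1, e2⟩ := h'.indep.eq_of_pair e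
    exact ⟨e1.symm, e2.symm⟩
  · rintro ⟨rfl, rfl⟩
    -- Outside the plane of the face the map may be extended arbitrarily.
    obtain ⟨f, hf⟩ := LinearMap.exists_extend
      ((Module.Basis.span h.indep).constr ℝ ![A - O, C' - O])
    have hf' : ∀ i, f (![A - O, C - O] i) = ![A - O, C' - O] i := by
      intro i
      have := LinearMap.congr_fun hf (Module.Basis.span h.indep i)
      rw [Module.Basis.constr_basis] at this
      rw [← this, LinearMap.comp_apply, Submodule.subtype_apply, Module.Basis.span_apply]
    have h0 : f (A - O) = A - O := hf' 0
    have h1 : f (C - O) = C' - O := hf' 1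
    refine ⟨AffineMap.mk' (fun P => f (P - O) + O) f O (fun P => by simp), ?_, ?_, ?_, ?_⟩
    · simp
    · simp only [AffineMap.coe_mk', h0, sub_add_cancel]
    · simp only [AffineMap.coe_mk', h1, sub_add_cancel]
    · simp only [AffineMap.coe_mk']
      rw [h.eq, map_add, map_smul, map_smul, h0, h1, ← h'.eq, sub_add_cancel]

end IsFace
end Face

/-! ### Rescaling a face with parallel sides -/

section ScaledFace

/-- The coordinate of the far vertex of a face with parameters `p`, `q` along the side with
parameter `p`. -/
noncomputable def sideCoord (p q : ℝ) : ℝ := p * (p * q + 1) / (p + q)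

theorem sideCoord_pos {p q : ℝ} (hp : 0 < p) (hq : 0 < q) : 0 < sideCoord p q := by
  unfold sideCoord; positivity

theorem sideCoord_add {p q : ℝ} (hp : 0 < p) (hq : 0 < q) :
    sideCoord p q + sideCoord q p = p * q + 1 := by
  unfold sideCoord
  have : p + q ≠ 0 := by positivity
  rw [add_comm q p, ← add_div, div_eq_iff this]; ring

theorem sideCoord_div {p q : ℝ} (hp : 0 < p) (hq : 0 < q) :
    sideCoord q p / (sideCoord p q * (sideCoord p q + sideCoord q p - 1)) = (p ^ 2)⁻¹ := by
  rw [sideCoord_add hp hq]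
  unfold sideCoord
  have : q + p ≠ 0 := by positivity
  rw [add_sub_cancel_right]
  field_simp
  ring

/-- The parameters are inverse square roots of the opposite ratios: `p ^ 2 = l * (l + m - 1) / m`,
while `p * q = l + m - 1`. -/
theorem exists_sideCoord_eq {l m : ℝ} (hl : 0 < l) (hm : 0 < m) (h : 1 < l + m) :
    ∃ p q, 0 < p ∧ 0 < q ∧ sideCoord p q = l ∧ sideCoord q p = m := by
  have hs : 0 < l + m - 1 := by linarith
  have hr : 0 < l * (l + m - 1) / m := by positivity
  set p := √(l * (l + m - 1) / m) with hp
  have hp0 : 0 < p := Real.sqrt_pos.2 hr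
  have hp2 : p ^ 2 = l * (l + m - 1) / m := Real.sq_sqrt hr.le
  set q := (l + m - 1) / p with hq
  have hq0 : 0 < q := by positivity
  have hpq : p * q = l + m - 1 := by rw [hq]; field_simp
  have hlq : m * p = l * q := by
    apply mul_left_cancel₀ hp0.ne'
    have : m * p ^ 2 = l * (l + m - 1) := by rw [hp2]; field_simp
    linear_combination this - l * hpq
  refine ⟨p, q, hp0, hq0, ?_, ?_⟩
  · rw [sideCoord, div_eq_iff (by positivity), hpq]
    linear_combination hlq
  · rw [sideCoord, div_eq_iff (by positivity), mul_comm q p, hpq]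
    linear_combination -hlq

theorem sideCoord_injective {p q p' q' : ℝ} (hp : 0 < p) (hq : 0 < q) (hp' : 0 < p')
    (hq' : 0 < q') : (sideCoord p q = sideCoord p' q' ∧ sideCoord q p = sideCoord q' p') ↔
      p = p' ∧ q = q' := by
  constructor
  · rintro ⟨h1, h2⟩
    have e1 := sideCoord_div hp hq
    have e2 := sideCoord_div hq hp
    rw [h1, h2, sideCoord_div hp' hq', inv_inj, sq_eq_sq₀ hp'.le hp.le] at e1
    rw [h1, h2, sideCoord_div hq' hp', inv_inj, sq_eq_sq₀ hq'.le hq.le] at e2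
    exact ⟨e1.symm, e2.symm⟩
  · rintro ⟨rfl, rfl⟩; exact ⟨rfl, rfl⟩

/-- The right-hand side is the sum of the far coordinates of the original face and the left-hand
side is that sum times `x * y` for the rescaled one; both are twice the area in units of the
original parallelogram. -/
theorem areaRel_iff {p q x y : ℝ} (hp : 0 < p) (hq : 0 < q) :
    AreaRel p q x y ↔ (p * q + 1) / (p + q) * farCoord p q x y * y +
      (p * q + 1) / (p + q) * farCoord q p y x * x = p * q + 1 := by
  have h1 : p + q ≠ 0 := by positivity
  have h2 : p * q + 1 ≠ 0 := by positivity
  have e : (p * q + 1) / (p + q) * farCoord p q x y * y +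
      (p * q + 1) / (p + q) * farCoord q p y x * x =
      (p * q + 1) / (p + q) ^ 2 * ((q * x + p * y) ^ 2 - (x - y) ^ 2) := by
    unfold farCoord
    rw [add_comm q p]
    field_simp
    ring
  rw [e, AreaRel, div_mul_eq_mul_div, div_eq_iff (by positivity)]
  constructor
  · intro h; rw [h]
  · intro h; exact mul_left_cancel₀ h2 h

variable {d : ℕ} {O A B C O' A' B' C' : EuclideanSpace ℝ (Fin d)} {p q x y : ℝ}

namespace IsFace

/-- The far vertex is the intersection of two lines with prescribed directions. The resulting linear
system has determinant `l + m - 1 = p * q` for the original coordinates, hence a unique solution. -/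
theorem scaled_coords {l m s t : ℝ} (h : IsFace O A B C (sideCoord p q) (sideCoord q p))
    (hp : 0 < p) (hq : 0 < q) (h' : IsFace O' A' B' C' l m) (hA : A' - O' = x • (A - O))
    (hC : C' - O' = y • (C - O)) (hAB : B' - A' = s • (B - A)) (hCB : B' - C' = t • (B - C)) :
    l * x = (p * q + 1) / (p + q) * farCoord p q x y ∧
      m * y = (p * q + 1) / (p + q) * farCoord q p y x := by
  have e := h'.eq
  rw [hA, hC, smul_smul, smul_smul] at e
  set α := l * x
  set β := m * y
  have f1 : α • (A - O) + β • (C - O) =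
      (x + s * (sideCoord p q - 1)) • (A - O) + (s * sideCoord q p) • (C - O) := by
    have : B' - O' = (A' - O') + s • ((B - O) - (A - O)) := by
      rw [sub_sub_sub_cancel_right, ← hAB]; abel
    rw [← e, this, hA, h.eq]; module
  have f2 : α • (A - O) + β • (C - O) =
      (t * sideCoord p q) • (A - O) + (y + t * (sideCoord q p - 1)) • (C - O) := by
    have : B' - O' = (C' - O') + t • ((B - O) - (C - O)) := by
      rw [sub_sub_sub_cancel_right, ← hCB]; abel
    rw [← e, this, hC, h.eq]; module
  obtain ⟨a1, a2⟩ := h.indep.eq_of_pair f1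
  obtain ⟨a3, a4⟩ := h.indep.eq_of_pair f2
  have hadd := sideCoord_add hp hq
  have hl := sideCoord_pos hp hq
  have hm := sideCoord_pos hq hp
  have hpq : p + q ≠ 0 := by positivity
  have hl1 : sideCoord p q = p * ((p * q + 1) / (p + q)) := by unfold sideCoord; ring
  have hm1 : sideCoord q p = q * ((p * q + 1) / (p + q)) := by
    unfold sideCoord; rw [add_comm q p]; ring
  have hfar : sideCoord q p * x + (sideCoord p q - 1) * y = q * farCoord p q x y := by
    rw [hl1, hm1]; unfold farCoord; field_simp; ring
  have hfar' : sideCoord p q * y + (sideCoord q p - 1) * x = p * farCoord q p y x := by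
    rw [hl1, hm1]; unfold farCoord; rw [add_comm q p]; field_simp; ring
  have b1 : sideCoord q p * (α - x) = β * (sideCoord p q - 1) := by rw [a1, a2]; ring
  have b2 : sideCoord p q * (β - y) = α * (sideCoord q p - 1) := by rw [a3, a4]; ring
  constructor
  · apply mul_left_cancel₀ (mul_pos hp hq).ne'
    have : α * (p * q) = sideCoord p q * (q * farCoord p q x y) := by
      rw [← hfar]
      linear_combination sideCoord p q * b1 + (sideCoord p q - 1) * b2 - α * hadd
    rw [hl1] at this
    linear_combination this
  · apply mul_left_cancel₀ (mul_pos hp hq).ne'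
    have : β * (p * q) = sideCoord q p * (p * farCoord q p y x) := by
      rw [← hfar']
      linear_combination sideCoord q p * b2 + (sideCoord q p - 1) * b1 - β * hadd
    rw [hm1] at this
    linear_combination this

theorem areaRel_of_quadArea_eq {l m s t : ℝ}
    (h : IsFace O A B C (sideCoord p q) (sideCoord q p)) (hp : 0 < p) (hq : 0 < q)
    (h' : IsFace O' A' B' C' l m) (hx : 0 < x) (hy : 0 < y) (hA : A' - O' = x • (A - O))
    (hC : C' - O' = y • (C - O)) (hAB : B' - A' = s • (B - A)) (hCB : B' - C' = t • (B - C))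
    (harea : quadArea O A B C = quadArea O' A' B' C') :
    AreaRel p q x y ∧ 0 < farCoord p q x y ∧ 0 < farCoord q p y x := by
  obtain ⟨h1, h2⟩ := h.scaled_coords hp hq h' hA hC hAB hCB
  have hk : 0 < (p * q + 1) / (p + q) := by positivity
  have hg := h.parallelogramArea_pos
  refine ⟨?_, ?_, ?_⟩
  · rw [areaRel_iff hp hq, ← h1, ← h2, ← sideCoord_add hp hq]
    rw [h.quadArea_eq, h'.quadArea_eq, hA, hC, parallelogramArea_smul hx hy] at harea
    apply mul_right_cancel₀ hg.ne'
    linear_combination -2 * harea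
  · exact pos_of_mul_pos_right (h1 ▸ mul_pos h'.l_pos hx) hk.le
  · exact pos_of_mul_pos_right (h2 ▸ mul_pos h'.m_pos hy) hk.le

/-- The far vertex of the face with the near vertex `O` and sides `x • a`, `y • c` that has sides
parallel to those of the face with parameters `p`, `q` and sides `a`, `c`. -/
noncomputable def _root_.scaledFarVertex (p q x y : ℝ) (O a c : EuclideanSpace ℝ (Fin d)) :
    EuclideanSpace ℝ (Fin d) :=
  O + (((p * q + 1) / (p + q) * farCoord p q x y) • a +
    ((p * q + 1) / (p + q) * farCoord q p y x) • c)

/-- By the area relation the new coordinates sum to `(p * q + 1) / (x * y)`, so `hxy` is precisely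
strict convexity at the far vertex. -/
theorem scaled (h : IsFace O A B C (sideCoord p q) (sideCoord q p)) (hp : 0 < p) (hq : 0 < q)
    (hx : 0 < x) (hy : 0 < y) (hrel : AreaRel p q x y) (hfar : 0 < farCoord p q x y)
    (hfar' : 0 < farCoord q p y x) (hxy : x * y < p * q + 1) :
    IsFace O' (O' + x • (A - O)) (scaledFarVertex p q x y O' (A - O) (C - O))
      (O' + y • (C - O)) ((p * q + 1) / (p + q) * farCoord p q x y / x)
      ((p * q + 1) / (p + q) * farCoord q p y x / y) where
  indep := by
    rw [add_sub_cancel_left, add_sub_cancel_left]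
    rw [LinearIndependent.pair_iff]
    intro s t hst
    rw [smul_smul, smul_smul] at hst
    obtain ⟨h1, h2⟩ := LinearIndependent.pair_iff.1 h.indep _ _ hst
    exact ⟨(mul_eq_zero.1 h1).resolve_right hx.ne', (mul_eq_zero.1 h2).resolve_right hy.ne'⟩
  l_pos := by positivity
  m_pos := by positivity
  one_lt := by
    rw [areaRel_iff hp hq] at hrel
    rw [div_add_div _ _ hx.ne' hy.ne', lt_div_iff₀ (mul_pos hx hy)]
    linarith
  eq := by
    rw [scaledFarVertex, add_sub_cancel_left, add_sub_cancel_left, add_sub_cancel_left, smul_smul,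
      smul_smul, div_mul_cancel₀ _ hx.ne', div_mul_cancel₀ _ hy.ne']

theorem quadArea_scaled (h : IsFace O A B C (sideCoord p q) (sideCoord q p)) (hp : 0 < p)
    (hq : 0 < q) (hx : 0 < x) (hy : 0 < y) (hrel : AreaRel p q x y)
    (hfar : 0 < farCoord p q x y) (hfar' : 0 < farCoord q p y x) (hxy : x * y < p * q + 1) :
    quadArea O' (O' + x • (A - O)) (scaledFarVertex p q x y O' (A - O) (C - O))
      (O' + y • (C - O)) = quadArea O A B C := by
  rw [(h.scaled hp hq hx hy hrel hfar hfar' hxy).quadArea_eq, h.quadArea_eq, add_sub_cancel_left,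
    add_sub_cancel_left, parallelogramArea_smul hx hy, sideCoord_add hp hq]
  rw [areaRel_iff hp hq] at hrel
  rw [div_add_div _ _ hx.ne' hy.ne', mul_comm x (_ * farCoord q p y x), hrel, ← mul_assoc]
  congr 1
  field_simp

theorem scaledFarVertex_sub (h : IsFace O A B C (sideCoord p q) (sideCoord q p)) (hp : 0 < p)
    (hq : 0 < q) : scaledFarVertex p q x y O' (A - O) (C - O) - (O' + x • (A - O)) =
      (farCoord q p y x / q) • (B - A) := by
  have hpq : p + q ≠ 0 := by positivity
  rw [show B - A = (B - O) - (A - O) by abel, h.eq, scaledFarVertex]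
  have e1 : farCoord q p y x / q * sideCoord q p = (p * q + 1) / (p + q) * farCoord q p y x := by
    unfold sideCoord; rw [add_comm q p]; field_simp
  have e2 : farCoord q p y x / q * (sideCoord p q - 1) =
      (p * q + 1) / (p + q) * farCoord p q x y - x := by
    unfold sideCoord farCoord; rw [add_comm q p]; field_simp; ring
  have : (farCoord q p y x / q) • (sideCoord p q • (A - O) + sideCoord q p • (C - O) - (A - O)) =
      (farCoord q p y x / q * (sideCoord p q - 1)) • (A - O) +
        (farCoord q p y x / q * sideCoord q p) • (C - O) := by module
  rw [this, e1, e2]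
  module

theorem scaledFarVertex_swap : scaledFarVertex p q x y O A C = scaledFarVertex q p y x O C A := by
  unfold scaledFarVertex
  rw [add_comm q p, mul_comm q p, add_comm (_ • A)]

theorem scaledFarVertex_sub' (h : IsFace O A B C (sideCoord p q) (sideCoord q p)) (hp : 0 < p)
    (hq : 0 < q) : scaledFarVertex p q x y O' (A - O) (C - O) - (O' + y • (C - O)) =
      (farCoord p q x y / p) • (B - C) := by
  rw [scaledFarVertex_swap]
  exact h.swap.scaledFarVertex_sub hq hp

end IsFace
end ScaledFace

/-! ### Nets in terms of the star of the central point -/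

section Net

variable {d : ℕ}

local notation "𝔼" => EuclideanSpace ℝ (Fin d)

theorem IsConvexQuad.quadArea_rotate {A B C D : 𝔼} (h : IsConvexQuad A B C D) :
    quadArea B C D A = quadArea A B C D := by
  obtain ⟨l, m, hf⟩ := h.exists_isFace
  rw [hf.quadArea_rotate, hf.quadArea_eq]

/-- The neighbours of the central point of a `2 × 2` net, in cyclic order. -/
def sidePt (P : Fin 3 → Fin 3 → 𝔼) : Fin 4 → 𝔼 := ![P 1 0, P 2 1, P 1 2, P 0 1]

/-- The corners of a `2 × 2` net, in cyclic order. -/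
def cornerPt (P : Fin 3 → Fin 3 → 𝔼) : Fin 4 → 𝔼 := ![P 2 0, P 2 2, P 0 2, P 0 0]

theorem isNet_iff (P : Fin 3 → Fin 3 → 𝔼) : IsNet (m := 2) (n := 2) P ↔
    ∀ i, IsConvexQuad (P 1 1) (sidePt P i) (cornerPt P i) (sidePt P (i + 1)) := by
  constructor
  · intro h i
    have h0 : IsConvexQuad (P 1 0) (P 2 0) (P 2 1) (P 1 1) := h 1 0
    have h1 : IsConvexQuad (P 1 1) (P 2 1) (P 2 2) (P 1 2) := h 1 1
    have h2 : IsConvexQuad (P 0 1) (P 1 1) (P 1 2) (P 0 2) := h 0 1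
    have h3 : IsConvexQuad (P 0 0) (P 1 0) (P 1 1) (P 0 1) := h 0 0
    fin_cases i
    exacts [h0.rotate.rotate.rotate, h1, h2.rotate, h3.rotate.rotate]
  · intro h i j
    have h0 : IsConvexQuad (P 1 1) (P 1 0) (P 2 0) (P 2 1) := h 0
    have h1 : IsConvexQuad (P 1 1) (P 2 1) (P 2 2) (P 1 2) := h 1
    have h2 : IsConvexQuad (P 1 1) (P 1 2) (P 0 2) (P 0 1) := h 2
    have h3 : IsConvexQuad (P 1 1) (P 0 1) (P 0 0) (P 1 0) := h 3
    fin_cases i <;> fin_cases j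
    exacts [h3.rotate.rotate, h2.rotate.rotate.rotate, h0.rotate, h1]

theorem faceArea_eq_iff {P P' : Fin 3 → Fin 3 → 𝔼} (hP : IsNet (m := 2) (n := 2) P)
    (hP' : IsNet (m := 2) (n := 2) P') :
    (∀ i j, faceArea (m := 2) (n := 2) P i j = faceArea (m := 2) (n := 2) P' i j) ↔
    ∀ i, quadArea (P 1 1) (sidePt P i) (cornerPt P i) (sidePt P (i + 1)) =
      quadArea (P' 1 1) (sidePt P' i) (cornerPt P' i) (sidePt P' (i + 1)) := by
  have key : ∀ {P : Fin 3 → Fin 3 → 𝔼}, IsNet (m := 2) (n := 2) P →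
      faceArea (m := 2) (n := 2) P 1 0 =
        quadArea (P 1 1) (sidePt P 0) (cornerPt P 0) (sidePt P (0 + 1)) ∧
      faceArea (m := 2) (n := 2) P 1 1 =
        quadArea (P 1 1) (sidePt P 1) (cornerPt P 1) (sidePt P (1 + 1)) ∧
      faceArea (m := 2) (n := 2) P 0 1 =
        quadArea (P 1 1) (sidePt P 2) (cornerPt P 2) (sidePt P (2 + 1)) ∧
      faceArea (m := 2) (n := 2) P 0 0 =
        quadArea (P 1 1) (sidePt P 3) (cornerPt P 3) (sidePt P (3 + 1)) := by
    intro P hP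
    rw [isNet_iff] at hP
    exact ⟨(hP 0).quadArea_rotate, rfl,
      (hP 2).rotate.rotate.quadArea_rotate.trans ((hP 2).rotate.quadArea_rotate.trans
        (hP 2).quadArea_rotate), (hP 3).rotate.quadArea_rotate.trans (hP 3).quadArea_rotate⟩
  obtain ⟨k0, k1, k2, k3⟩ := key hP
  obtain ⟨k0', k1', k2', k3'⟩ := key hP'
  constructor
  · intro h i
    have h0 := h 1 0
    have h1 := h 1 1
    have h2 := h 0 1
    have h3 := h 0 0
    rw [k0, k0'] at h0
    rw [k1, k1'] at h1
    rw [k2, k2'] at h2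
    rw [k3, k3'] at h3
    fin_cases i
    exacts [h0, h1, h2, h3]
  · intro h i j
    have h0 := h 0
    have h1 := h 1
    have h2 := h 2
    have h3 := h 3
    rw [← k0, ← k0'] at h0
    rw [← k1, ← k1'] at h1
    rw [← k2, ← k2'] at h2
    rw [← k3, ← k3'] at h3
    fin_cases i <;> fin_cases j
    exacts [h3, h2, h0, h1]

/-- The lines `AB` and `A'B'` are parallel. -/
def ParallelPairs (A B A' B' : 𝔼) : Prop :=
  (affineSpan ℝ {A, B}).Parallel (affineSpan ℝ {A', B'})

theorem ParallelPairs.swap {A B A' B' : 𝔼} (h : ParallelPairs A B A' B') :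
    ParallelPairs B A B' A' := by
  unfold ParallelPairs at *
  rwa [Set.pair_comm B A, Set.pair_comm B' A']

theorem ParallelPairs.exists_smul {A B A' B' : 𝔼} (h : ParallelPairs A B A' B') :
    ∃ r : ℝ, B' - A' = r • (B - A) := by
  have h1 := AffineSubspace.affineSpan_pair_parallel_iff_vectorSpan_eq.1 h
  have h2 : B' -ᵥ A' ∈ vectorSpan ℝ {A, B} := h1 ▸ vsub_rev_mem_vectorSpan_pair ℝ A' B'
  obtain ⟨r, hr⟩ := mem_vectorSpan_pair_rev.1 h2
  exact ⟨r, hr.symm⟩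

theorem parallelPairs_of_smul {A B A' B' : 𝔼} {r : ℝ} (hr : r ≠ 0)
    (h : B' - A' = r • (B - A)) : ParallelPairs A B A' B' := by
  rw [ParallelPairs, AffineSubspace.affineSpan_pair_parallel_iff_vectorSpan_eq,
    vectorSpan_pair_rev, vectorSpan_pair_rev, vsub_eq_sub, vsub_eq_sub, h,
    Submodule.span_singleton_smul_eq (isUnit_iff_ne_zero.2 hr)]

theorem parallelNets_iff (P P' : Fin 3 → Fin 3 → 𝔼) :
    ParallelNets (m := 2) (n := 2) P P' ↔
    ∀ i, ParallelPairs (P 1 1) (sidePt P i) (P' 1 1) (sidePt P' i) ∧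
      ParallelPairs (sidePt P i) (cornerPt P i) (sidePt P' i) (cornerPt P' i) ∧
      ParallelPairs (sidePt P (i + 1)) (cornerPt P i) (sidePt P' (i + 1)) (cornerPt P' i) := by
  constructor
  · rintro ⟨h, h'⟩ i
    have e1 : ∀ i j, ParallelPairs (P (Fin.castSucc i) j) (P (Fin.succ i) j)
      (P' (Fin.castSucc i) j) (P' (Fin.succ i) j) := h
    have e2 : ∀ i j, ParallelPairs (P i (Fin.castSucc j)) (P i (Fin.succ j))
      (P' i (Fin.castSucc j)) (P' i (Fin.succ j)) := h'
    fin_cases i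
    exacts [⟨(e2 1 0).swap, e1 1 0, (e2 2 0).swap⟩, ⟨e1 1 1, e2 2 1, e1 1 2⟩,
      ⟨e2 1 1, (e1 0 2).swap, e2 0 1⟩, ⟨(e1 0 1).swap, (e2 0 0).swap, (e1 0 0).swap⟩]
  · intro h
    obtain ⟨a0, b0, c0⟩ := h 0
    obtain ⟨a1, b1, c1⟩ := h 1
    obtain ⟨a2, b2, c2⟩ := h 2
    obtain ⟨a3, b3, c3⟩ := h 3
    constructor <;> intro i j <;> fin_cases i <;> fin_cases j
    exacts [c3.swap, a3.swap, b2.swap, b0, a1, c1, b3.swap, c2, a0.swap, a2, c0.swap, b1]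

/-- The points of the face `i` of a net, in the coordinates given by the parameters `p`, `q`. -/
def HasParams (P : Fin 3 → Fin 3 → 𝔼) (p q : Fin 4 → ℝ) : Prop :=
  ∀ i, IsFace (P 1 1) (sidePt P i) (cornerPt P i) (sidePt P (i + 1))
    (sideCoord (p i) (q (i + 1))) (sideCoord (q (i + 1)) (p i))

theorem IsNet.exists_params {P : Fin 3 → Fin 3 → 𝔼} (hP : IsNet (m := 2) (n := 2) P) :
    ∃ p q, (∀ i, 0 < p i) ∧ (∀ i, 0 < q i) ∧ HasParams P p q := by
  rw [isNet_iff] at hP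
  have key : ∀ i, ∃ p q, 0 < p ∧ 0 < q ∧ IsFace (P 1 1) (sidePt P i) (cornerPt P i)
      (sidePt P (i + 1)) (sideCoord p q) (sideCoord q p) := by
    intro i
    obtain ⟨l, m, h⟩ := (hP i).exists_isFace
    obtain ⟨p, q, hp, hq, rfl, rfl⟩ := exists_sideCoord_eq h.l_pos h.m_pos h.one_lt
    exact ⟨p, q, hp, hq, h⟩
  choose p q hp hq h using key
  -- The second parameter is reindexed by its side, so that `p i` and `q i` both refer to side `i`,
  -- seen from its two faces.
  refine ⟨p, fun i => q (i - 1), hp, fun i => hq _, fun i => ?_⟩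
  simpa only [add_sub_cancel_right] using h i

namespace HasParams

variable {P : Fin 3 → Fin 3 → EuclideanSpace ℝ (Fin d)} {p q : Fin 4 → ℝ}

theorem splits_iff (h : HasParams P p q) (hp : ∀ i, 0 < p i) (hq : ∀ i, 0 < q i) :
    SplitsIntoAffineSymmetricPairs P ↔
      (q 1 = p 1 ∧ p 0 = q 2 ∧ p 2 = q 0 ∧ p 3 = q 3) ∨
      (q 2 = p 2 ∧ p 1 = q 3 ∧ p 3 = q 1 ∧ p 0 = q 0) := by
  have f0 := (h 3).swap.affineSymmetric_iff (h 0)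
  have f1 := (h 0).swap.affineSymmetric_iff (h 1)
  have f2 := (h 2).affineSymmetric_iff (h 1).swap
  have f3 := (h 3).affineSymmetric_iff (h 2).swap
  simp only [Fin.reduceAdd, zero_add] at f0 f1 f2 f3
  rw [sideCoord_injective (hq _) (hp _) (hp _) (hq _)] at f0 f1
  rw [sideCoord_injective (hp _) (hq _) (hq _) (hp _)] at f2 f3
  have g0 : AffineSymmetric (P 1 0) (P 1 1) (P 0 1) (P 0 0) (P 2 1) (P 2 0) ↔
      q 0 = p 0 ∧ p 3 = q 1 := by
    refine Iff.trans (exists_congr fun φ => ?_) f0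
    exact ⟨fun ⟨a, b, c, d⟩ => ⟨b, a, c, d⟩, fun ⟨a, b, c, d⟩ => ⟨b, a, c, d⟩⟩
  have g2 : AffineSymmetric (P 1 1) (P 1 2) (P 0 2) (P 0 1) (P 2 2) (P 2 1) ↔
      p 2 = q 2 ∧ q 3 = p 1 := by
    refine Iff.trans (exists_congr fun φ => ?_) f2
    exact ⟨fun ⟨a, b, c, d⟩ => ⟨a, b, d, c⟩, fun ⟨a, b, c, d⟩ => ⟨a, b, d, c⟩⟩
  have g3 : AffineSymmetric (P 0 1) (P 1 1) (P 1 0) (P 0 0) (P 1 2) (P 0 2) ↔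
      p 3 = q 3 ∧ q 0 = p 2 := by
    refine Iff.trans (exists_congr fun φ => ?_) f3
    exact ⟨fun ⟨a, b, c, d⟩ => ⟨b, a, c, d⟩, fun ⟨a, b, c, d⟩ => ⟨b, a, c, d⟩⟩
  have g1 : AffineSymmetric (P 1 1) (P 2 1) (P 2 0) (P 1 0) (P 2 2) (P 1 2) ↔
      q 1 = p 1 ∧ p 0 = q 2 := by
    refine Iff.trans (exists_congr fun φ => ?_) f1
    exact ⟨fun ⟨a, b, c, d⟩ => ⟨a, b, d, c⟩, fun ⟨a, b, c, d⟩ => ⟨a, b, d, c⟩⟩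
  rw [SplitsIntoAffineSymmetricPairs, g0, g1, g2, g3]
  grind

theorem equalOppositeRatios_iff (h : HasParams P p q) (hp : ∀ i, 0 < p i) (hq : ∀ i, 0 < q i) :
    EqualOppositeRatios P ↔ p = q := by
  have e0 : oppositeRatio (P 1 0) (P 1 1) (P 0 1) (P 0 0) = (q 0 ^ 2)⁻¹ :=
    (h 3).swap.oppositeRatio_eq'.trans (sideCoord_div (hq 0) (hp 3))
  have e0' : oppositeRatio (P 1 0) (P 1 1) (P 2 1) (P 2 0) = (p 0 ^ 2)⁻¹ :=
    (h 0).oppositeRatio_eq'.trans (sideCoord_div (hp 0) (hq 1))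
  have e2 : oppositeRatio (P 1 1) (P 1 2) (P 0 2) (P 0 1) = (p 2 ^ 2)⁻¹ :=
    (h 2).oppositeRatio_eq.trans (sideCoord_div (hp 2) (hq 3))
  have e2' : oppositeRatio (P 1 1) (P 1 2) (P 2 2) (P 2 1) = (q 2 ^ 2)⁻¹ :=
    (h 1).swap.oppositeRatio_eq.trans (sideCoord_div (hq 2) (hp 1))
  have e3 : oppositeRatio (P 0 1) (P 1 1) (P 1 0) (P 0 0) = (p 3 ^ 2)⁻¹ :=
    (h 3).oppositeRatio_eq'.trans (sideCoord_div (hp 3) (hq 0))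
  have e3' : oppositeRatio (P 0 1) (P 1 1) (P 1 2) (P 0 2) = (q 3 ^ 2)⁻¹ :=
    (h 2).swap.oppositeRatio_eq'.trans (sideCoord_div (hq 3) (hp 2))
  have e1 : oppositeRatio (P 1 1) (P 2 1) (P 2 0) (P 1 0) = (q 1 ^ 2)⁻¹ :=
    (h 0).swap.oppositeRatio_eq.trans (sideCoord_div (hq 1) (hp 0))
  have e1' : oppositeRatio (P 1 1) (P 2 1) (P 2 2) (P 1 2) = (p 1 ^ 2)⁻¹ :=
    (h 1).oppositeRatio_eq.trans (sideCoord_div (hp 1) (hq 2))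
  rw [EqualOppositeRatios, e0, e0', e1, e1', e2, e2', e3, e3']
  simp only [inv_inj, sq_eq_sq₀ (hp _).le (hq _).le, sq_eq_sq₀ (hq _).le (hp _).le]
  constructor
  · rintro ⟨h0, h2, h3, h1⟩
    ext i
    fin_cases i
    exacts [h0.symm, h1.symm, h2, h3]
  · rintro rfl
    simp

theorem side_ne (h : HasParams P p q) (i : Fin 4) : sidePt P i - P 1 1 ≠ 0 :=
  (h i).indep.ne_zero 0

/-- A deformation through parallel nets with equal face areas near the net with parameters `p`, `q`
forces one of the two conditions. -/
theorem cases_of_deformable (h : HasParams P p q) (hp : ∀ i, 0 < p i) (hq : ∀ i, 0 < q i)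
    (hP : IsNet (m := 2) (n := 2) P) (hdef : Deformable (m := 2) (n := 2) P) :
    (q 1 = p 1 ∧ p 0 = q 2 ∧ p 2 = q 0 ∧ p 3 = q 3) ∨
    (q 2 = p 2 ∧ p 1 = q 3 ∧ p 3 = q 1 ∧ p 0 = q 0) ∨ p = q := by
  obtain ⟨F, hF, ⟨t₀, ht₀⟩, hnet, hpar, harea, hcong⟩ := hdef
  have hFc : ∀ i j, Continuous fun t => F t i j := fun i j =>
    (continuous_apply j).comp ((continuous_apply i).comp hF)
  have hsc : ∀ i, Continuous fun t => sidePt (F t) i := by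
    intro i
    fin_cases i
    exacts [hFc 1 0, hFc 2 1, hFc 1 2, hFc 0 1]
  have hpar' : ∀ t i, (∃ r : ℝ, sidePt (F t) i - F t 1 1 = r • (sidePt P i - P 1 1)) ∧
      (∃ r : ℝ, cornerPt (F t) i - sidePt (F t) i = r • (cornerPt P i - sidePt P i)) ∧
      ∃ r : ℝ, cornerPt (F t) i - sidePt (F t) (i + 1) =
        r • (cornerPt P i - sidePt P (i + 1)) := by
    intro t i
    have := (parallelNets_iff _ _).1 (hpar t₀ t) i
    rw [ht₀] at this
    exact ⟨this.1.exists_smul, this.2.1.exists_smul, this.2.2.exists_smul⟩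
  choose hx hs hr using hpar'
  -- The factors are written through inner products to make their continuity visible.
  let x : unitInterval → Fin 4 → ℝ := fun t i =>
    inner ℝ (sidePt P i - P 1 1) (sidePt (F t) i - F t 1 1) /
      inner ℝ (sidePt P i - P 1 1) (sidePt P i - P 1 1)
  have hx' : ∀ t i, sidePt (F t) i - F t 1 1 = x t i • (sidePt P i - P 1 1) := by
    intro t i
    obtain ⟨r, hr⟩ := hx t i
    have : x t i = r := by
      simp only [x]
      rw [hr, inner_smul_right, mul_div_cancel_right₀]
      exact (real_inner_self_pos.2 (h.side_ne i)).ne'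
    rw [this, hr]
  have hxc : ∀ i, Continuous fun t => x t i := fun i =>
    (continuous_const.inner ((hsc i).sub (hFc 1 1))).div_const _
  have hx0 : ∀ i, x t₀ i = 1 := fun i => by
    simp only [x]
    rw [ht₀, div_self (real_inner_self_pos.2 (h.side_ne i)).ne']
  -- The factors equal `1` at `t₀`, so they are positive nearby, and a neighbourhood in `[0, 1]`
  -- supplies infinitely many parameters.
  have hU : {t | ∀ i, 0 < x t i} ∈ nhds t₀ := by
    refine Filter.eventually_all.2 fun i => ?_
    exact (hxc i).continuousAt.eventually
      (lt_mem_nhds (one_pos.trans_eq (hx0 i).symm))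
  have hinf := infinite_of_mem_nhds t₀ hU
  let T := hinf.natEmbedding
  have hface : ∀ t, ∀ i, ∃ l m, IsFace (F t 1 1) (sidePt (F t) i) (cornerPt (F t) i)
      (sidePt (F t) (i + 1)) l m := fun t i => ((isNet_iff _).1 (hnet t) i).exists_isFace
  have harea' : ∀ t i, quadArea (P 1 1) (sidePt P i) (cornerPt P i) (sidePt P (i + 1)) =
      quadArea (F t 1 1) (sidePt (F t) i) (cornerPt (F t) i) (sidePt (F t) (i + 1)) := by
    intro t
    refine (faceArea_eq_iff hP (hnet t)).1 fun i j => ?_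
    rw [← harea t₀ t, ht₀]
  have hrel : ∀ t, (∀ i, 0 < x t i) → ∀ i, AreaRel (p i) (q (i + 1)) (x t i) (x t (i + 1)) ∧
      0 < farCoord (p i) (q (i + 1)) (x t i) (x t (i + 1)) ∧
      0 < farCoord (q (i + 1)) (p i) (x t (i + 1)) (x t i) := by
    intro t ht i
    obtain ⟨l, m, hf⟩ := hface t i
    obtain ⟨s, hs⟩ := hs t i
    obtain ⟨r, hr⟩ := hr t i
    exact (h i).areaRel_of_quadArea_eq (hp _) (hq _) hf (ht _) (ht _) (hx' t i) (hx' t _)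
      hs hr (harea' t i)
  have hcorner : ∀ s t, x s = x t → ∀ i,
      cornerPt (F s) i - F s 1 1 = cornerPt (F t) i - F t 1 1 := by
    have key : ∀ t i, cornerPt (F t) i - F t 1 1 =
        ((p i * q (i + 1) + 1) / (p i + q (i + 1)) *
          farCoord (p i) (q (i + 1)) (x t i) (x t (i + 1))) • (sidePt P i - P 1 1) +
        ((p i * q (i + 1) + 1) / (p i + q (i + 1)) *
          farCoord (q (i + 1)) (p i) (x t (i + 1)) (x t i)) • (sidePt P (i + 1) - P 1 1) := by
      intro t i
      obtain ⟨l, m, hf⟩ := hface t i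
      obtain ⟨s, hs⟩ := hs t i
      obtain ⟨r, hr⟩ := hr t i
      obtain ⟨e1, e2⟩ := (h i).scaled_coords (hp _) (hq _) hf (hx' t i) (hx' t _) hs hr
      rw [hf.eq, ← e1, ← e2, hx', hx', smul_smul, smul_smul]
    intro s t hst i
    rw [key, key, hst]
  -- Nets with the same factors differ by a translation, which non-congruence forbids.
  have hxinj : Function.Injective x := by
    intro s t hst
    by_contra hne
    apply hcong s t hne
    have hside : ∀ i, sidePt (F s) i - F s 1 1 = sidePt (F t) i - F t 1 1 := fun i => by
      rw [hx', hx', hst]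
    have hc := hcorner s t hst
    refine ⟨IsometryEquiv.addRight (F t 1 1 - F s 1 1), ?_⟩
    have tr : ∀ A B : 𝔼, A - F s 1 1 = B - F t 1 1 →
        IsometryEquiv.addRight (F t 1 1 - F s 1 1) A = B := by
      intro A B hAB
      rw [IsometryEquiv.addRight_apply]
      rw [sub_eq_iff_eq_add] at hAB
      rw [hAB]; abel
    intro i j
    fin_cases i <;> fin_cases j
    exacts [tr _ _ (hc 3), tr _ _ (hside 3), tr _ _ (hc 2), tr _ _ (hside 0),
      tr _ _ ((sub_self _).trans (sub_self _).symm), tr _ _ (hside 2), tr _ _ (hc 0), tr _ _ (hside 1),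
      tr _ _ (hc 1)]
  exact classification_of_sequence hp hq (X := fun n => x (T n))
    (fun a b hab => T.injective (Subtype.ext (hxinj hab))) (fun n => (T n).2)
    (fun n i => (hrel _ (T n).2 i).1) (fun n i => (hrel _ (T n).2 i).2.1)
    (fun n i => (hrel _ (T n).2 i).2.2)

end HasParams
end Net

/-! ### Construction of deformations -/

section Deformation

variable {d : ℕ}

local notation "𝔼" => EuclideanSpace ℝ (Fin d)

/-- The `2 × 2` net with central point `O`, neighbours `e` of `O` and corners `b`. -/
def starNet (O : 𝔼) (e b : Fin 4 → 𝔼) : Fin 3 → Fin 3 → 𝔼 :=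
  ![![b 3, e 3, b 2], ![e 0, O, e 2], ![b 0, e 1, b 1]]

theorem sidePt_starNet (O : 𝔼) (e b : Fin 4 → 𝔼) : sidePt (starNet O e b) = e := by
  ext1 i; fin_cases i <;> rfl

theorem cornerPt_starNet (O : 𝔼) (e b : Fin 4 → 𝔼) : cornerPt (starNet O e b) = b := by
  ext1 i; fin_cases i <;> rfl

theorem starNet_self (P : Fin 3 → Fin 3 → 𝔼) : starNet (P 1 1) (sidePt P) (cornerPt P) = P := by
  ext1 i; ext1 j; fin_cases i <;> fin_cases j <;> rfl

/-- The net parallel to `P` with the same central point and the edges at the central point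
scaled by `x`. -/
noncomputable def scaledNet (P : Fin 3 → Fin 3 → 𝔼) (p q x : Fin 4 → ℝ) : Fin 3 → Fin 3 → 𝔼 :=
  starNet (P 1 1) (fun i => P 1 1 + x i • (sidePt P i - P 1 1)) fun i =>
    scaledFarVertex (p i) (q (i + 1)) (x i) (x (i + 1)) (P 1 1) (sidePt P i - P 1 1)
      (sidePt P (i + 1) - P 1 1)

theorem continuous_scaledNet (P : Fin 3 → Fin 3 → 𝔼) (p q : Fin 4 → ℝ) :
    Continuous (scaledNet P p q) := by
  have hs : ∀ i, Continuous fun x : Fin 4 → ℝ => P 1 1 + x i • (sidePt P i - P 1 1) := by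
    intro i; fun_prop
  have hb : ∀ i, Continuous fun x : Fin 4 → ℝ =>
      scaledFarVertex (p i) (q (i + 1)) (x i) (x (i + 1)) (P 1 1) (sidePt P i - P 1 1)
      (sidePt P (i + 1) - P 1 1) := by
    intro i
    unfold scaledFarVertex farCoord
    fun_prop
  refine continuous_pi fun i => continuous_pi fun j => ?_
  fin_cases i <;> fin_cases j
  exacts [hb 3, hs 3, hb 2, hs 0, continuous_const, hs 2, hb 0, hs 1, hb 1]

theorem farCoord_one_one {p q : ℝ} (hp : 0 < p) (hq : 0 < q) : farCoord p q 1 1 = p := by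
  unfold farCoord
  rw [div_eq_iff (by positivity)]; ring

/-- The scaling factors for which the scaled net is a net with the same face areas. -/
def Admissible (p q x : Fin 4 → ℝ) : Prop :=
  ∀ i, 0 < x i ∧ AreaRel (p i) (q (i + 1)) (x i) (x (i + 1)) ∧
    0 < farCoord (p i) (q (i + 1)) (x i) (x (i + 1)) ∧
    0 < farCoord (q (i + 1)) (p i) (x (i + 1)) (x i) ∧ x i * x (i + 1) < p i * q (i + 1) + 1

namespace HasParams

variable {P : Fin 3 → Fin 3 → EuclideanSpace ℝ (Fin d)} {p q : Fin 4 → ℝ}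

theorem scaledNet_one (h : HasParams P p q) (hp : ∀ i, 0 < p i) (hq : ∀ i, 0 < q i) :
    scaledNet P p q 1 = P := by
  conv_rhs => rw [← starNet_self P]
  unfold scaledNet
  congr 1
  · ext1 i; simp
  · ext1 i
    have e := (h i).eq
    rw [sub_eq_iff_eq_add'] at e
    rw [e, scaledFarVertex, Pi.one_apply, Pi.one_apply, farCoord_one_one (hp _) (hq _),
      farCoord_one_one (hq _) (hp _)]
    unfold sideCoord
    rw [add_comm (q (i + 1)) (p i), mul_comm (q (i + 1)) (p i)]
    congr 3 <;> ring

theorem isNet_scaledNet (h : HasParams P p q) (hp : ∀ i, 0 < p i) (hq : ∀ i, 0 < q i)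
    {x : Fin 4 → ℝ} (hx : Admissible p q x) : IsNet (m := 2) (n := 2) (scaledNet P p q x) := by
  rw [isNet_iff]
  intro i
  obtain ⟨h0, hrel, h1, h2, h3⟩ := hx i
  rw [scaledNet, sidePt_starNet, cornerPt_starNet]
  exact ((h i).scaled (hp _) (hq _) h0 (hx _).1 hrel h1 h2 h3).isConvexQuad

theorem parallel_scaledNet (h : HasParams P p q) (hp : ∀ i, 0 < p i) (hq : ∀ i, 0 < q i)
    {x : Fin 4 → ℝ} (hx : Admissible p q x) :
    ParallelNets (m := 2) (n := 2) P (scaledNet P p q x) := by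
  rw [parallelNets_iff]
  intro i
  obtain ⟨h0, hrel, h1, h2, h3⟩ := hx i
  rw [scaledNet, sidePt_starNet, cornerPt_starNet]
  exact ⟨parallelPairs_of_smul h0.ne' (add_sub_cancel_left _ _),
    parallelPairs_of_smul (div_pos h2 (hq _)).ne' ((h i).scaledFarVertex_sub (hp _) (hq _)),
    parallelPairs_of_smul (div_pos h1 (hp _)).ne' ((h i).scaledFarVertex_sub' (hp _) (hq _))⟩

theorem faceArea_scaledNet (h : HasParams P p q) (hP : IsNet (m := 2) (n := 2) P)
    (hp : ∀ i, 0 < p i) (hq : ∀ i, 0 < q i) {x : Fin 4 → ℝ} (hx : Admissible p q x) (i j : Fin 2) :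
    faceArea (m := 2) (n := 2) (scaledNet P p q x) i j = faceArea (m := 2) (n := 2) P i j := by
  refine (faceArea_eq_iff (h.isNet_scaledNet hp hq hx) hP).2 (fun i => ?_) i j
  obtain ⟨h0, hrel, h1, h2, h3⟩ := hx i
  rw [scaledNet, sidePt_starNet, cornerPt_starNet]
  exact (h i).quadArea_scaled (hp _) (hq _) h0 (hx _).1 hrel h1 h2 h3

/-- The isometry fixes the common central point, so it preserves the lengths of the edges there, and
these determine the positive factors. -/
theorem eq_of_congruent (h : HasParams P p q) {x y : Fin 4 → ℝ} (hx : Admissible p q x)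
    (hy : Admissible p q y)
    (hc : CongruentNets (m := 2) (n := 2) (scaledNet P p q x) (scaledNet P p q y)) (i : Fin 4) :
    x i = y i := by
  obtain ⟨g, hg⟩ := hc
  have hgs : ∀ i, g (P 1 1 + x i • (sidePt P i - P 1 1)) =
      P 1 1 + y i • (sidePt P i - P 1 1) := by
    intro i
    fin_cases i
    exacts [hg 1 0, hg 2 1, hg 1 2, hg 0 1]
  have hgO : g (P 1 1) = P 1 1 := hg 1 1
  have := g.dist_eq (P 1 1 + x i • (sidePt P i - P 1 1)) (P 1 1)
  rw [hgs, hgO, dist_eq_norm, dist_eq_norm, add_sub_cancel_left, add_sub_cancel_left, norm_smul,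
    norm_smul, Real.norm_of_nonneg (hx i).1.le, Real.norm_of_nonneg (hy i).1.le] at this
  exact (mul_right_cancel₀ (norm_ne_zero_iff.2 (h.side_ne i)) this).symm

open Set Filter Topology in
/-- A curve of solutions of the area relations starting at the trivial one gives a deformation. -/
theorem deformable_of_curve (h : HasParams P p q) (hP : IsNet (m := 2) (n := 2) P)
    (hp : ∀ i, 0 < p i) (hq : ∀ i, 0 < q i) {X : ℝ → Fin 4 → ℝ} (hX : ContinuousOn X (Ici 0))
    (hX0 : X 0 = 1) (hrel : ∀ u, 0 ≤ u → ∀ i, AreaRel (p i) (q (i + 1)) (X u i) (X u (i + 1)))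
    {k : Fin 4} (hinj : InjOn (fun u => X u k) (Ici 0)) : Deformable (m := 2) (n := 2) P := by
  have hXi : ∀ i, ContinuousWithinAt (fun u => X u i) (Ici 0) 0 := fun i =>
    (continuous_apply i).continuousAt.comp_continuousWithinAt (hX 0 self_mem_Ici)
  -- Apart from the area relation, admissibility consists of strict inequalities that hold at `1`,
  -- so it persists on a short interval.
  have hev : ∀ᶠ u in 𝓝[≥] (0 : ℝ), Admissible p q (X u) := by
    refine eventually_all.2 fun i => ?_
    have c1 : ContinuousWithinAt (fun u => farCoord (p i) (q (i + 1)) (X u i) (X u (i + 1)))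
        (Ici 0) 0 := by
      have := hXi i
      have := hXi (i + 1)
      unfold farCoord
      fun_prop
    have c2 : ContinuousWithinAt (fun u => farCoord (q (i + 1)) (p i) (X u (i + 1)) (X u i))
        (Ici 0) 0 := by
      have := hXi i
      have := hXi (i + 1)
      unfold farCoord
      fun_prop
    have c3 := (hXi i).mul (hXi (i + 1))
    have hpq : 0 < p i * q (i + 1) := mul_pos (hp _) (hq _)
    have e0 := (hXi i).eventually_const_lt (u := 0) (by simp [hX0])
    have e1 := c1.eventually_const_lt (u := 0) (by
      simp [hX0, farCoord_one_one (hp _) (hq _), hp])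
    have e2 := c2.eventually_const_lt (u := 0) (by
      simp [hX0, farCoord_one_one (hq _) (hp _), hq])
    have e3 := c3.eventually_lt_const (u := p i * q (i + 1) + 1) (by simp [hX0, hpq])
    filter_upwards [e0, e1, e2, e3, self_mem_nhdsWithin] with u h0 h1 h2 h3 hu
    exact ⟨h0, hrel u hu i, h1, h2, h3⟩
  obtain ⟨δ, hδ, hδX⟩ := (mem_nhdsGE_iff_exists_Icc_subset).1 hev
  have hδ0 : 0 < δ := hδ
  have hmem : ∀ t : unitInterval, δ * t ∈ Icc 0 δ := fun t =>
    ⟨mul_nonneg hδ0.le t.2.1, mul_le_of_le_one_right hδ0.le t.2.2⟩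
  have had : ∀ t : unitInterval, Admissible p q (X (δ * t)) := fun t => hδX (hmem t)
  refine ⟨fun t => scaledNet P p q (X (δ * t)), ?_, ⟨0, ?_⟩, ?_, ?_, ?_, ?_⟩
  · refine (continuous_scaledNet P p q).comp (hX.comp_continuous (by fun_prop) ?_)
    exact fun t => (hmem t).1
  · change scaledNet P p q (X (δ * 0)) = P
    rw [mul_zero, hX0]
    exact h.scaledNet_one hp hq
  · exact fun t => h.isNet_scaledNet hp hq (had t)
  · intro s t
    have h1 := h.parallel_scaledNet hp hq (had s)
    have h2 := h.parallel_scaledNet hp hq (had t)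
    exact ⟨fun i j => (h1.1 i j).symm.trans (h2.1 i j), fun i j => (h1.2 i j).symm.trans (h2.2 i j)⟩
  · intro s t i j
    rw [h.faceArea_scaledNet hP hp hq (had s), h.faceArea_scaledNet hP hp hq (had t)]
  · intro s t hst hc
    have := hinj (hmem s).1 (hmem t).1 (h.eq_of_congruent (had s) (had t) hc k)
    exact hst (Subtype.ext (mul_left_cancel₀ hδ0.ne' this))

end HasParams

/-- The solution `y` near `1` of the area relation `AreaRel p q u y`. -/
noncomputable def areaBranch (p q u : ℝ) : ℝ :=
  ((p + q) ^ 2 - (q ^ 2 - 1) * u ^ 2) / ((p * q + 1) * u + (p + q) * √(u ^ 2 - 1 + p ^ 2))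

theorem areaBranch_denom_pos {p q u : ℝ} (hp : 0 < p) (hq : 0 < q) (hu : 1 ≤ u) :
    0 < (p * q + 1) * u + (p + q) * √(u ^ 2 - 1 + p ^ 2) := by
  have := Real.sqrt_nonneg (u ^ 2 - 1 + p ^ 2)
  positivity

/-- This is the quadratic formula with the root moved to the denominator, which stays valid when `p
= 1` and the relation is linear in `y`. -/
theorem areaRel_areaBranch {p q u : ℝ} (hp : 0 < p) (hq : 0 < q) (hu : 1 ≤ u) :
    AreaRel p q u (areaBranch p q u) := by
  have hD := areaBranch_denom_pos hp hq hu
  have hr : √(u ^ 2 - 1 + p ^ 2) ^ 2 = u ^ 2 - 1 + p ^ 2 := Real.sq_sqrt (by nlinarith)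
  unfold areaBranch
  set r := √(u ^ 2 - 1 + p ^ 2)
  set D := (p * q + 1) * u + (p + q) * r with hDdef
  set N := (p + q) ^ 2 - (q ^ 2 - 1) * u ^ 2 with hN
  have key : (p ^ 2 - 1) * N + 2 * (p * q + 1) * u * D = D ^ 2 := by
    rw [hN, hDdef]; linear_combination -(p + q) ^ 2 * hr
  have e : (p ^ 2 - 1) * (N / D) ^ 2 + 2 * (p * q + 1) * u * (N / D) = N := by
    field_simp
    linear_combination N * key
  unfold AreaRel
  linear_combination e + hN

theorem areaBranch_one {p q : ℝ} (hp : 0 < p) (hq : 0 < q) : areaBranch p q 1 = 1 := by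
  unfold areaBranch
  rw [one_pow, sub_self, zero_add, Real.sqrt_sq hp.le, div_eq_one_iff_eq (by positivity)]
  ring

open Set in
theorem continuousOn_areaBranch {p q : ℝ} (hp : 0 < p) (hq : 0 < q) :
    ContinuousOn (fun t => areaBranch p q (1 + t)) (Ici 0) := by
  unfold areaBranch
  refine ContinuousOn.div (by fun_prop) (by fun_prop) fun t ht => ?_
  exact (areaBranch_denom_pos hp hq (le_add_of_nonneg_right ht)).ne'

namespace HasParams

open Set

variable {P : Fin 3 → Fin 3 → EuclideanSpace ℝ (Fin d)} {p q : Fin 4 → ℝ}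

/-- In each of the first two cases two adjacent faces impose the same relation once the opposite
factors are both `1 + t`, so one branch per pair suffices. If `p = q`, a single hyperbola parameter
serves all four faces. -/
theorem deformable_of_cases (h : HasParams P p q) (hP : IsNet (m := 2) (n := 2) P)
    (hp : ∀ i, 0 < p i) (hq : ∀ i, 0 < q i)
    (hcase : (q 1 = p 1 ∧ p 0 = q 2 ∧ p 2 = q 0 ∧ p 3 = q 3) ∨
      (q 2 = p 2 ∧ p 1 = q 3 ∧ p 3 = q 1 ∧ p 0 = q 0) ∨ p = q) :
    Deformable (m := 2) (n := 2) P := by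
  have hcont : ContinuousOn (fun t : ℝ => 1 + t) (Ici 0) := by fun_prop
  rcases hcase with ⟨h1, h2, h3, h4⟩ | ⟨h1, h2, h3, h4⟩ | hpq
  · refine h.deformable_of_curve hP hp hq (k := 0) (X := fun t => ![1 + t,
      areaBranch (p 0) (q 1) (1 + t), 1 + t, areaBranch (p 2) (q 3) (1 + t)]) ?_ ?_ ?_ ?_
    · refine continuousOn_pi.2 fun i => ?_
      fin_cases i
      exacts [hcont, continuousOn_areaBranch (hp _) (hq _), hcont,
        continuousOn_areaBranch (hp _) (hq _)]
    · ext i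
      fin_cases i <;> simp [areaBranch_one, hp, hq]
    · intro u hu i
      have e1 := areaRel_areaBranch (hp 0) (hq 1) (le_add_of_nonneg_right hu)
      have e2 := areaRel_areaBranch (hp 2) (hq 3) (le_add_of_nonneg_right hu)
      have e1' := e1.symm
      have e2' := e2.symm
      nth_rewrite 1 [h1] at e1'
      nth_rewrite 1 [h2] at e1'
      nth_rewrite 1 [← h4] at e2'
      nth_rewrite 1 [h3] at e2'
      fin_cases i
      exacts [e1, e1', e2, e2']
    · intro a _ b _ hab
      exact add_left_cancel hab
  · refine h.deformable_of_curve hP hp hq (k := 1) (X := fun t => ![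
      areaBranch (q 1) (p 0) (1 + t), 1 + t, areaBranch (p 1) (q 2) (1 + t), 1 + t]) ?_ ?_ ?_ ?_
    · refine continuousOn_pi.2 fun i => ?_
      fin_cases i
      exacts [continuousOn_areaBranch (hq _) (hp _), hcont,
        continuousOn_areaBranch (hp _) (hq _), hcont]
    · ext i
      fin_cases i <;> simp [areaBranch_one, hp, hq]
    · intro u hu i
      have e1 := areaRel_areaBranch (hq 1) (hp 0) (le_add_of_nonneg_right hu)
      have e2 := areaRel_areaBranch (hp 1) (hq 2) (le_add_of_nonneg_right hu)
      have e1' := e1.symm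
      have e2' := e2.symm
      nth_rewrite 1 [← h3] at e1
      nth_rewrite 1 [h4] at e1
      nth_rewrite 1 [h1] at e2'
      nth_rewrite 1 [h2] at e2'
      fin_cases i
      exacts [e1', e2, e2', e1]
    · intro a _ b _ hab
      exact add_left_cancel hab
  -- `AreaRel.of_param` needs opposite signs of `sinh` at adjacent sides, which is consistent
  -- because the cycle has even length.
  · subst hpq
    refine h.deformable_of_curve hP hp hq (k := 0) (X := fun t => ![
      Real.cosh t + p 0 * Real.sinh t, Real.cosh t - p 1 * Real.sinh t,
      Real.cosh t + p 2 * Real.sinh t, Real.cosh t - p 3 * Real.sinh t]) ?_ ?_ ?_ ?_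
    · refine continuousOn_pi.2 fun i => Continuous.continuousOn ?_
      have h1 := Real.continuous_cosh
      have h2 := Real.continuous_sinh
      fin_cases i
      exacts [h1.add (h2.const_mul _), h1.sub (h2.const_mul _), h1.add (h2.const_mul _),
        h1.sub (h2.const_mul _)]
    · ext i
      fin_cases i <;> simp
    · intro u hu i
      have hcs := Real.cosh_sq_sub_sinh_sq u
      fin_cases i
      exacts [AreaRel.of_param hcs, (AreaRel.of_param hcs).symm, AreaRel.of_param hcs,
        (AreaRel.of_param hcs).symm]
    · refine StrictMonoOn.injOn fun a ha b hb hab => ?_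
      change Real.cosh a + p 0 * Real.sinh a < Real.cosh b + p 0 * Real.sinh b
      have h1 : Real.cosh a < Real.cosh b := by
        rw [Real.cosh_lt_cosh, abs_of_nonneg ha, abs_of_nonneg hb]; exact hab
      have h2 : p 0 * Real.sinh a < p 0 * Real.sinh b :=
        mul_lt_mul_of_pos_left (Real.sinh_lt_sinh.2 hab) (hp 0)
      exact add_lt_add h1 h2

end HasParams
end Deformation

theorem theorem2p1 (d : ℕ) (P : Fin 3 → Fin 3 → EuclideanSpace ℝ (Fin d))
    (hP : IsNet (m := 2) (n := 2) P) :
    Deformable (m := 2) (n := 2) P ↔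
      SplitsIntoAffineSymmetricPairs P ∨ EqualOppositeRatios P := by
  obtain ⟨p, q, hp, hq, h⟩ := IsNet.exists_params hP
  rw [h.splits_iff hp hq, h.equalOppositeRatios_iff hp hq, or_assoc]
  exact ⟨h.cases_of_deformable hp hq hP, h.deformable_of_cases hP hp hq⟩
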